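/- **Theorem.** Let $p:E\to B$ be a Serre fibration of topological spaces (for instance a Hurewicz fibration), $e_0\in E$, $b_0=p(e_0)$, let $F=p^{-1}(b_0)$ be the fibre, based at $e_0$, and let $i:F\hookrightarrow E$ be the inclusion. Let $s:B\to E$ be a based homotopy section: a continuous map with $s(b_0)=e_0$ and $p\circ s\simeq \mathrm{Id}_B$ relative to $b_0$. For $\alpha\in\pi_k(B,b_0)$ and $\beta\in\pi_l(F,e_0)$, $k,l\ge 1$, let $[s_*\alpha,i_*\beta]\in\pi_{k+l-1}(E,e_0)$ be the Whitehead product. There is exactly one element $\{\alpha,\beta\}_s\in\pi_{k+l-1}(F,e_0)$, the James brace product of $\alpha$ and $\beta$, with $i_*\{\alpha,\beta\}_s=[s_*\alpha,i_*\beta]$. Let $\varphi_s:\Omega B\times\Omega F\to\Omega E$ be the map $\varphi_s(\gamma,\delta)=(s\circ\gamma)\cdot(i\circ\delta)$, where $\cdot$ is the concatenation of loops. For a based loop space $Y=\Omega X$, or a product of two of them with the componentwise structure, the Samelson product $\pi_k(Y)\times\pi_l(Y)\to\pi_{k+l}(Y)$, $k,l\ge 0$, is the one induced by the commutator map $(x,y)\mapsto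 (xy)(x^{-1}y^{-1})$ of $Y$. Then the following are equivalent: 1. the James brace product vanishes identically, i.e. $\{\alpha,\beta\}_s=0$ for all $k,l\ge1$, $\alpha\in\pi_k(B,b_0)$, $\beta\in\pi_l(F,e_0)$; 2. $(\varphi_s)_*:\pi_*(\Omega B\times\Omega F)\to\pi_*(\Omega E)$ is an isomorphism of algebras with respect to the Samelson product, i.e. in every degree $n\ge0$ it is an isomorphism of groups $\pi_n(\Omega B\times\Omega F)\to\pi_n(\Omega E)$ (for $n=0$ with the group structure induced by the concatenation of loops), and it preserves the Samelson product in all degrees $k,l\ge 0$. -/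

import Mathlib

open scoped unitInterval Topology Topology.Homotopy

noncomputable section

namespace BraceProduct

/-! ### Serre fibrations, induced maps, loop maps -/

/-- A map with the homotopy lifting property for all cubes `I^n`, `n ≥ 0`.
Every Hurewicz fibration is one. -/
def IsSerreFibration {E B : Type*} [TopologicalSpace E] [TopologicalSpace B] (p : C(E, B)) : Prop :=
  ∀ (n : ℕ) (H : C((I^ Fin n) × I, B)) (f : C(I^ Fin n, E)), (∀ y, p (f y) = H (y, 0)) →
    ∃ G : C((I^ Fin n) × I, E), (∀ y, G (y, 0) = f y) ∧ ∀ z, p (G z) = H z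

/-- The map `f_* : π_n(X, x) → π_n(Y, y)` induced by a map `f` with `f x = y`. -/
def inducedMap {X Y : Type*} [TopologicalSpace X] [TopologicalSpace Y] {x : X} {y : Y}
    (f : C(X, Y)) (hf : f x = y) (n : ℕ) : π_ n X x → π_ n Y y :=
  Quotient.map
    (fun a : GenLoop (Fin n) X x =>
      (⟨f.comp a.1, fun z hz => by
        rw [ContinuousMap.comp_apply, a.2 z hz, hf]⟩ : GenLoop (Fin n) Y y))
    (fun _ _ h => h.map fun H => H.compContinuousMap f)

/-- The map `Ωf : Ω(X, x) → Ω(Y, y)` induced by a map `f` with `f x = y`. -/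
def loopMap {X Y : Type*} [TopologicalSpace X] [TopologicalSpace Y] {x : X} {y : Y}
    (f : C(X, Y)) (hf : f x = y) : C(Path x x, Path y y) where
  toFun γ := (γ.map f.continuous).cast hf.symm hf.symm
  continuous_toFun := by
    refine Path.continuous_uncurry_iff.mp ?_
    change Continuous fun q : Path x x × I => f (q.1 q.2)
    fun_prop

/-! ### Coordinates on cubes -/

/-- The retraction of the cube `I^n` that maps the inner cube `[1/3, 2/3]^n` affinely onto `I^n` and
the rest (the collar) to the boundary. -/
def stretch {n : ℕ} (u : I^ Fin n) : I^ Fin n :=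
  fun i => Set.projIcc 0 1 zero_le_one (3 * (u i : ℝ) - 1)

/-- The depth in the collar: `0` on the inner cube `[1/3, 2/3]^n`, and `1` on the boundary. -/
def depth {n : ℕ} (u : I^ Fin n) : I :=
  Finset.univ.sup fun i => Set.projIcc 0 1 zero_le_one (max (1 - 3 * (u i : ℝ)) (3 * (u i : ℝ) - 2))

/-- The first block of coordinates. -/
def fstBlock {k l : ℕ} (w : I^ Fin (k + l)) : I^ Fin k := fun i => w (Fin.castAdd l i)

/-- The second block of coordinates. -/
def sndBlock {k l : ℕ} (w : I^ Fin (k + l)) : I^ Fin l := fun j => w (Fin.natAdd k j)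

/-- `τ ↦ (squareFst τ, squareSnd τ)` runs once around the boundary of the square `I²`, through the
vertices `(0,0), (1,0), (1,1), (0,1), (0,0)`, one side in each quarter of `I`. -/
def squareFst (τ : I) : I := Set.projIcc 0 1 zero_le_one (min (4 * (τ : ℝ)) (3 - 4 * (τ : ℝ)))

/-- See `squareFst`. -/
def squareSnd (τ : I) : I := Set.projIcc 0 1 zero_le_one (min (4 * (τ : ℝ) - 1) (4 - 4 * (τ : ℝ)))

lemma continuous_stretch {n : ℕ} : Continuous (stretch (n := n)) := by
  unfold stretch
  refine continuous_pi fun i => continuous_projIcc.comp ?_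
  fun_prop

lemma continuous_depth {n : ℕ} : Continuous (depth (n := n)) := by
  unfold depth
  refine Continuous.finset_sup_apply fun i _ => continuous_projIcc.comp ?_
  fun_prop

lemma continuous_fstBlock {k l : ℕ} : Continuous (fstBlock (k := k) (l := l)) := by
  unfold fstBlock; fun_prop

lemma continuous_sndBlock {k l : ℕ} : Continuous (sndBlock (k := k) (l := l)) := by
  unfold sndBlock; fun_prop

lemma continuous_squareFst : Continuous squareFst := by
  unfold squareFst
  refine continuous_projIcc.comp ?_
  fun_prop

lemma continuous_squareSnd : Continuous squareSnd := by
  unfold squareSnd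
  refine continuous_projIcc.comp ?_
  fun_prop

lemma isClosed_boundary (n : ℕ) : IsClosed (Cube.boundary (Fin n)) := by
  have h : Cube.boundary (Fin n) = ⋃ i : Fin n, {y : I^ Fin n | y i = 0 ∨ y i = 1} := by
    ext y; simp [Cube.boundary]
  rw [h]
  refine isClosed_iUnion_of_finite fun i => ?_
  exact (isClosed_eq (continuous_apply i) continuous_const).union
    (isClosed_eq (continuous_apply i) continuous_const)

lemma depth_boundary {n : ℕ} {u : I^ Fin n} (hu : u ∈ Cube.boundary (Fin n)) : depth u = 1 := by
  obtain ⟨i, hi⟩ := hu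
  refine le_antisymm unitInterval.le_one' ?_
  refine le_trans (le_of_eq ?_) (Finset.le_sup (Finset.mem_univ i))
  symm
  refine Set.projIcc_of_right_le _ ?_
  rcases hi with hi | hi <;> rw [hi] <;> norm_num

lemma stretch_boundary {k l : ℕ} {w : I^ Fin (k + l)} (hw : depth w ≠ 0) :
    stretch (fstBlock w) ∈ Cube.boundary (Fin k) ∨
      stretch (sndBlock w) ∈ Cube.boundary (Fin l) := by
  have key : ∃ i, 1 - 3 * (w i : ℝ) > 0 ∨ 3 * (w i : ℝ) - 2 > 0 := by
    by_contra! hcon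
    refine hw (le_antisymm ?_ unitInterval.nonneg')
    refine Finset.sup_le fun i _ => le_of_eq ?_
    exact Set.projIcc_of_le_left _ (max_le (hcon i).1 (hcon i).2)
  obtain ⟨i, hi⟩ := key
  have hs : Set.projIcc (0 : ℝ) 1 zero_le_one (3 * (w i : ℝ) - 1) = 0 ∨
      Set.projIcc (0 : ℝ) 1 zero_le_one (3 * (w i : ℝ) - 1) = 1 := by
    rcases hi with hi | hi
    · exact Or.inl (Set.projIcc_of_le_left _ (by linarith))
    · exact Or.inr (Set.projIcc_of_right_le _ (by linarith))
  revert hs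
  refine Fin.addCases (fun j hs => Or.inl ⟨j, hs⟩) (fun j hs => Or.inr ⟨j, hs⟩) i

lemma square_boundary (τ : I) :
    (squareFst τ = 0 ∨ squareFst τ = 1) ∨ (squareSnd τ = 0 ∨ squareSnd τ = 1) := by
  rcases le_total (τ : ℝ) (1 / 4) with h1 | h1
  · exact Or.inr (Or.inl (Set.projIcc_of_le_left _ (min_le_of_left_le (by linarith))))
  rcases le_total (τ : ℝ) (1 / 2) with h2 | h2
  · exact Or.inl (Or.inr (Set.projIcc_of_right_le _ (le_min (by linarith) (by linarith))))
  rcases le_total (τ : ℝ) (3 / 4) with h3 | h3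
  · exact Or.inr (Or.inr (Set.projIcc_of_right_le _ (le_min (by linarith) (by linarith))))
  · exact Or.inl (Or.inl (Set.projIcc_of_le_left _ (min_le_of_right_le (by linarith))))

lemma squareFst_zero : squareFst 0 = 0 :=
  Set.projIcc_of_le_left _ (min_le_of_left_le (by norm_num))

lemma squareFst_one : squareFst 1 = 0 :=
  Set.projIcc_of_le_left _ (min_le_of_right_le (by norm_num))

lemma squareSnd_zero : squareSnd 0 = 0 :=
  Set.projIcc_of_le_left _ (min_le_of_left_le (by norm_num))

lemma squareSnd_one : squareSnd 1 = 0 :=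
  Set.projIcc_of_le_left _ (min_le_of_right_le (by norm_num))

/-! ### The Whitehead product -/

/-- The map `f ∪ g` on `∂(I^m × I^n) = (I^m × ∂I^n) ∪ (∂I^m × I^n)`: it is `f` of the first
coordinate on `I^m × ∂I^n`, and `g` of the second one on `∂I^m × I^n`. -/
def unionMap {X : Type*} {m n : ℕ} (f : (I^ Fin m) → X) (g : (I^ Fin n) → X)
    (z : (I^ Fin m) × (I^ Fin n)) : X := by
  classical
  exact if z.2 ∈ Cube.boundary (Fin n) then f z.1 else g z.2

/-- A map of pairs of degree `±1` from `(I^(k+l+1), ∂I^(k+l+1))` to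
`(∂(I^(k+1) × I^(l+1)), D)`, where `D = ({0} × I^k) × ({0} × I^l)` is a cell on which every `f ∪ g`
is constant; it presents `∂(I^(k+1) × I^(l+1))` as a sphere of dimension `k + l + 1`. For
`w = (τ, u, v)` with `(u, v)` in the inner cube of `I^k × I^l`, the coordinates `0` of the two
factors run with `τ` around the boundary of the square, and the other coordinates are those of
`(u, v)`, rescaled; in the collar, where the other coordinates lie on the boundary, the loop in the
square shrinks to `(0, 0)`. -/
def sphereMap (k l : ℕ) (w : I^ Fin (k + l + 1)) : (I^ Fin (k + 1)) × (I^ Fin (l + 1)) :=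
  (Fin.cons (σ (depth (Fin.tail w)) * squareFst (w 0)) (stretch (fstBlock (Fin.tail w))),
   Fin.cons (σ (depth (Fin.tail w)) * squareSnd (w 0)) (stretch (sndBlock (Fin.tail w))))

lemma cons_mem_boundary {n : ℕ} {x : I} {u : I^ Fin n}
    (h : (x = 0 ∨ x = 1) ∨ u ∈ Cube.boundary (Fin n)) :
    (Fin.cons x u : I^ Fin (n + 1)) ∈ Cube.boundary (Fin (n + 1)) := by
  rcases h with h | ⟨i, hi⟩
  · exact ⟨0, by simpa using h⟩
  · exact ⟨i.succ, by simpa using hi⟩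

lemma continuous_sphereMap (k l : ℕ) : Continuous (sphereMap k l) := by
  have ht : Continuous (fun w : I^ Fin (k + l + 1) => (Fin.tail w : I^ Fin (k + l))) := by
    unfold Fin.tail; fun_prop
  have hd := continuous_depth.comp ht
  refine Continuous.prodMk (continuous_pi fun i => ?_) (continuous_pi fun i => ?_)
  · refine Fin.cases ?_ (fun j => ?_) i
    · simp only [Fin.cons_zero]
      exact (unitInterval.continuous_symm.comp hd).mul
        (continuous_squareFst.comp (continuous_apply 0))
    · simp only [Fin.cons_succ]
      exact (continuous_apply j).comp (continuous_stretch.comp (continuous_fstBlock.comp ht))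
  · refine Fin.cases ?_ (fun j => ?_) i
    · simp only [Fin.cons_zero]
      exact (unitInterval.continuous_symm.comp hd).mul
        (continuous_squareSnd.comp (continuous_apply 0))
    · simp only [Fin.cons_succ]
      exact (continuous_apply j).comp (continuous_stretch.comp (continuous_sndBlock.comp ht))

/-- The image of `sphereMap` is in `∂(I^(k+1) × I^(l+1))`. -/
lemma sphereMap_mem (k l : ℕ) (w : I^ Fin (k + l + 1)) :
    (sphereMap k l w).1 ∈ Cube.boundary (Fin (k + 1)) ∨
      (sphereMap k l w).2 ∈ Cube.boundary (Fin (l + 1)) := by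
  by_cases hw : depth (Fin.tail w : I^ Fin (k + l)) = 0
  · have h1 : σ (depth (Fin.tail w : I^ Fin (k + l))) = 1 := by rw [hw]; simp
    rcases square_boundary (w 0) with h | h
    · left; refine cons_mem_boundary (Or.inl ?_); rwa [h1, one_mul]
    · right; refine cons_mem_boundary (Or.inl ?_); rwa [h1, one_mul]
  · rcases stretch_boundary hw with h | h
    · exact Or.inl (cons_mem_boundary (Or.inr h))
    · exact Or.inr (cons_mem_boundary (Or.inr h))

lemma sphereMap_boundary (k l : ℕ) {w : I^ Fin (k + l + 1)}
    (hw : w ∈ Cube.boundary (Fin (k + l + 1))) :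
    (sphereMap k l w).1 ∈ Cube.boundary (Fin (k + 1)) ∧
      (sphereMap k l w).2 ∈ Cube.boundary (Fin (l + 1)) := by
  have key : σ (depth (Fin.tail w : I^ Fin (k + l))) * squareFst (w 0) = 0 ∧
      σ (depth (Fin.tail w : I^ Fin (k + l))) * squareSnd (w 0) = 0 := by
    obtain ⟨i, hi⟩ := hw
    revert hi
    refine Fin.cases (fun hi => ?_) (fun j hj => ?_) i
    · rcases hi with hi | hi <;> rw [hi] <;>
        simp [squareFst_zero, squareFst_one, squareSnd_zero, squareSnd_one]
    · rw [depth_boundary (u := (Fin.tail w : I^ Fin (k + l))) ⟨j, hj⟩]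
      simp
  exact ⟨cons_mem_boundary (Or.inl (Or.inl key.1)), cons_mem_boundary (Or.inl (Or.inl key.2))⟩

lemma continuous_unionMap_sphereMap {X P : Type*} [TopologicalSpace X] [TopologicalSpace P] {x : X}
    {k l : ℕ} {f : P × (I^ Fin (k + 1)) → X} {g : P × (I^ Fin (l + 1)) → X} (hf : Continuous f)
    (hg : Continuous g) (hf' : ∀ q, ∀ a ∈ Cube.boundary (Fin (k + 1)), f (q, a) = x)
    (hg' : ∀ q, ∀ b ∈ Cube.boundary (Fin (l + 1)), g (q, b) = x) :
    Continuous fun z : P × (I^ Fin (k + l + 1)) =>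
      unionMap (fun a => f (z.1, a)) (fun b => g (z.1, b)) (sphereMap k l z.2) := by
  have hS : Continuous fun z : P × (I^ Fin (k + l + 1)) => sphereMap k l z.2 :=
    (continuous_sphereMap k l).comp continuous_snd
  have h1 : IsClosed {z : P × (I^ Fin (k + l + 1)) |
      (sphereMap k l z.2).2 ∈ Cube.boundary (Fin (l + 1))} :=
    (isClosed_boundary _).preimage (continuous_snd.comp hS)
  have h2 : IsClosed {z : P × (I^ Fin (k + l + 1)) |
      (sphereMap k l z.2).1 ∈ Cube.boundary (Fin (k + 1))} :=
    (isClosed_boundary _).preimage (continuous_fst.comp hS)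
  rw [← continuousOn_univ]
  have hu : (Set.univ : Set (P × (I^ Fin (k + l + 1)))) =
      {z | (sphereMap k l z.2).2 ∈ Cube.boundary (Fin (l + 1))} ∪
        {z | (sphereMap k l z.2).1 ∈ Cube.boundary (Fin (k + 1))} := by
    ext z; simpa using (sphereMap_mem k l z.2).symm
  rw [hu]
  refine ContinuousOn.union_of_isClosed ?_ ?_ h1 h2
  · have hc : Continuous fun z : P × (I^ Fin (k + l + 1)) => f (z.1, (sphereMap k l z.2).1) :=
      hf.comp (continuous_fst.prodMk (continuous_fst.comp hS))
    refine hc.continuousOn.congr fun z hz => ?_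
    exact if_pos hz
  · have hc : Continuous fun z : P × (I^ Fin (k + l + 1)) => g (z.1, (sphereMap k l z.2).2) :=
      hg.comp (continuous_fst.prodMk (continuous_snd.comp hS))
    refine hc.continuousOn.congr fun z hz => ?_
    by_cases hb : (sphereMap k l z.2).2 ∈ Cube.boundary (Fin (l + 1))
    · exact (if_pos hb).trans ((hf' _ _ hz).trans (hg' _ _ hb).symm)
    · exact if_neg hb

lemma continuous_unionMap_sphereMap' {X : Type*} [TopologicalSpace X] {x : X}
    {k l : ℕ} {f : (I^ Fin (k + 1)) → X} {g : (I^ Fin (l + 1)) → X} (hf : Continuous f)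
    (hg : Continuous g) (hf' : ∀ a ∈ Cube.boundary (Fin (k + 1)), f a = x)
    (hg' : ∀ b ∈ Cube.boundary (Fin (l + 1)), g b = x) :
    Continuous fun w : I^ Fin (k + l + 1) => unionMap f g (sphereMap k l w) := by
  have h := continuous_unionMap_sphereMap (P := Unit) (x := x) (k := k) (l := l)
    (f := fun z => f z.2) (g := fun z => g z.2)
    (hf.comp continuous_snd) (hg.comp continuous_snd) (fun _ => hf') (fun _ => hg')
  have h2 : Continuous fun w : I^ Fin (k + l + 1) => ((), w) := Continuous.prodMk_right ()
  have h3 := Continuous.comp h h2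
  simpa only [Function.comp_def] using h3

lemma unionMap_sphereMap_boundary {X : Type*} {x : X} {k l : ℕ} {f : (I^ Fin (k + 1)) → X}
    {g : (I^ Fin (l + 1)) → X} (hf' : ∀ a ∈ Cube.boundary (Fin (k + 1)), f a = x)
    {w : I^ Fin (k + l + 1)} (hw : w ∈ Cube.boundary (Fin (k + l + 1))) :
    unionMap f g (sphereMap k l w) = x :=
  (if_pos (sphereMap_boundary k l hw).2).trans (hf' _ (sphereMap_boundary k l hw).1)

/-- The Whitehead product on representatives: `f ∪ g` on the sphere `∂(I^(k+1) × I^(l+1))`. -/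
def whiteheadLoop {X : Type*} [TopologicalSpace X] {x : X} {k l : ℕ}
    (f : GenLoop (Fin (k + 1)) X x) (g : GenLoop (Fin (l + 1)) X x) :
    GenLoop (Fin (k + l + 1)) X x :=
  ⟨⟨fun w => unionMap f.1 g.1 (sphereMap k l w),
    continuous_unionMap_sphereMap' f.1.continuous g.1.continuous f.2 g.2⟩,
    fun _ hw => unionMap_sphereMap_boundary f.2 hw⟩

/-- The Whitehead product `π_(k+1)(X) × π_(l+1)(X) → π_(k+l+1)(X)`. -/
def whitehead {X : Type*} [TopologicalSpace X] {x : X} {k l : ℕ} :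
    π_ (k + 1) X x → π_ (l + 1) X x → π_ (k + l + 1) X x :=
  Quotient.map₂ whiteheadLoop (by
    rintro f f' ⟨F⟩ g g' ⟨G⟩
    have hF : ∀ q, ∀ a ∈ Cube.boundary (Fin (k + 1)), F (q, a) = x := fun q a ha =>
      (F.eq_fst q ha).trans (f.2 a ha)
    have hG : ∀ q, ∀ b ∈ Cube.boundary (Fin (l + 1)), G (q, b) = x := fun q b hb =>
      (G.eq_fst q hb).trans (g.2 b hb)
    refine ⟨⟨⟨⟨_, continuous_unionMap_sphereMap F.continuous G.continuous hF hG⟩, ?_, ?_⟩, ?_⟩⟩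
    · intro w
      change unionMap (fun a => F (0, a)) (fun b => G (0, b)) _ = unionMap f.1 g.1 _
      simp only [F.apply_zero, G.apply_zero]
    · intro w
      change unionMap (fun a => F (1, a)) (fun b => G (1, b)) _ = unionMap f'.1 g'.1 _
      simp only [F.apply_one, G.apply_one]
    · intro q w hw
      change unionMap (fun a => F (q, a)) (fun b => G (q, b)) _ = unionMap f.1 g.1 _
      rw [unionMap_sphereMap_boundary (hF q) hw, unionMap_sphereMap_boundary f.2 hw])

/-! ### The Samelson product -/

/-- An H-space with an inversion map, together with based null-homotopies of the commutator map
`(x, y) ↦ (x y) (x⁻¹ y⁻¹)` on the two axes `e × Y` and `Y × e`, that is, on the wedge `Y ∨ Y`.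
It is used only for based loop spaces and products of two of them, with the instances below. -/
class CommutatorHSpace (Y : Type*) [TopologicalSpace Y] extends HSpace Y where
  /-- inversion -/
  inv : C(Y, Y)
  /-- the null-homotopy on `e × Y` -/
  leftNull : C(I × Y, Y)
  /-- the null-homotopy on `Y × e` -/
  rightNull : C(I × Y, Y)
  leftNull_zero : ∀ y, leftNull (0, y) = hmul (hmul (e, y), hmul (inv e, inv y))
  leftNull_one : ∀ y, leftNull (1, y) = e
  leftNull_base : ∀ r, leftNull (r, e) = e
  rightNull_zero : ∀ y, rightNull (0, y) = hmul (hmul (y, e), hmul (inv y, inv e))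
  rightNull_one : ∀ y, rightNull (1, y) = e
  rightNull_base : ∀ r, rightNull (r, e) = e

/-- The commutator map `(x, y) ↦ (x y) (x⁻¹ y⁻¹)`. -/
def commutator {Y : Type*} [TopologicalSpace Y] [CommutatorHSpace Y] (x y : Y) : Y :=
  HSpace.hmul (HSpace.hmul (x, y),
    HSpace.hmul (CommutatorHSpace.inv x, CommutatorHSpace.inv y))

/-- The map `I^k × I^l → Y` obtained from the commutator map `(s, t) ↦ f(s) g(t) f(s)⁻¹ g(t)⁻¹` on
the inner cube by attaching in the collar the null-homotopy on the wedge. It is the end of a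
homotopy of maps `S^k × S^l → Y` that starts at the commutator map and extends the given
null-homotopy on `S^k ∨ S^l`. -/
def samelsonMap {Y : Type*} [TopologicalSpace Y] [CommutatorHSpace Y] {k l : ℕ}
    (f : (I^ Fin k) → Y) (g : (I^ Fin l) → Y) (w : I^ Fin (k + l)) : Y := by
  classical
  exact
    if stretch (fstBlock w) ∈ Cube.boundary (Fin k) then
      CommutatorHSpace.leftNull (depth w, g (stretch (sndBlock w)))
    else if stretch (sndBlock w) ∈ Cube.boundary (Fin l) then
      CommutatorHSpace.rightNull (depth w, f (stretch (fstBlock w)))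
    else commutator (f (stretch (fstBlock w))) (g (stretch (sndBlock w)))

section

variable {Y : Type*} [TopologicalSpace Y] [CommutatorHSpace Y] {k l : ℕ}

lemma samelsonMap_right {f : (I^ Fin k) → Y} {g : (I^ Fin l) → Y} {w : I^ Fin (k + l)}
    (hf : ∀ s ∈ Cube.boundary (Fin k), f s = HSpace.e)
    (hg : ∀ t ∈ Cube.boundary (Fin l), g t = HSpace.e)
    (hw : stretch (sndBlock w) ∈ Cube.boundary (Fin l)) :
    samelsonMap f g w = CommutatorHSpace.rightNull (depth w, f (stretch (fstBlock w))) := by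
  unfold samelsonMap
  split_ifs with h
  · rw [hf _ h, hg _ hw, CommutatorHSpace.leftNull_base, CommutatorHSpace.rightNull_base]
  · rfl

/-- On the inner cube the map is the commutator map. -/
lemma samelsonMap_inner {f : (I^ Fin k) → Y} {g : (I^ Fin l) → Y} {w : I^ Fin (k + l)}
    (hf : ∀ s ∈ Cube.boundary (Fin k), f s = HSpace.e)
    (hg : ∀ t ∈ Cube.boundary (Fin l), g t = HSpace.e) (hw : depth w = 0) :
    samelsonMap f g w = commutator (f (stretch (fstBlock w))) (g (stretch (sndBlock w))) := by
  unfold samelsonMap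
  split_ifs with h h'
  · rw [hw, hf _ h, CommutatorHSpace.leftNull_zero]; rfl
  · rw [hw, hg _ h', CommutatorHSpace.rightNull_zero]; rfl
  · rfl

lemma samelsonMap_boundary {f : (I^ Fin k) → Y} {g : (I^ Fin l) → Y} {w : I^ Fin (k + l)}
    (hw : w ∈ Cube.boundary (Fin (k + l))) : samelsonMap f g w = HSpace.e := by
  have hd := depth_boundary hw
  unfold samelsonMap
  split_ifs with h h'
  · rw [hd, CommutatorHSpace.leftNull_one]
  · rw [hd, CommutatorHSpace.rightNull_one]
  · exact absurd (stretch_boundary (w := w) (by rw [hd]; exact one_ne_zero)) (by tauto)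

lemma continuous_commutator : Continuous fun z : Y × Y => commutator z.1 z.2 := by
  unfold commutator
  exact HSpace.hmul.continuous.comp ((HSpace.hmul.continuous.comp continuous_id).prodMk
    (HSpace.hmul.continuous.comp ((CommutatorHSpace.inv.continuous.comp continuous_fst).prodMk
      (CommutatorHSpace.inv.continuous.comp continuous_snd))))

lemma continuous_samelsonMap {P : Type*} [TopologicalSpace P]
    {f : P × (I^ Fin k) → Y} {g : P × (I^ Fin l) → Y} (hf : Continuous f) (hg : Continuous g)
    (hf' : ∀ q, ∀ s ∈ Cube.boundary (Fin k), f (q, s) = HSpace.e)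
    (hg' : ∀ q, ∀ t ∈ Cube.boundary (Fin l), g (q, t) = HSpace.e) :
    Continuous fun z : P × (I^ Fin (k + l)) =>
      samelsonMap (fun s => f (z.1, s)) (fun t => g (z.1, t)) z.2 := by
  have hs : Continuous fun z : P × (I^ Fin (k + l)) => stretch (fstBlock z.2) :=
    continuous_stretch.comp (continuous_fstBlock.comp continuous_snd)
  have ht : Continuous fun z : P × (I^ Fin (k + l)) => stretch (sndBlock z.2) :=
    continuous_stretch.comp (continuous_sndBlock.comp continuous_snd)
  have hd : Continuous fun z : P × (I^ Fin (k + l)) => depth z.2 :=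
    continuous_depth.comp continuous_snd
  have hfs := hf.comp (continuous_fst.prodMk hs)
  have hgt := hg.comp (continuous_fst.prodMk ht)
  have h1 := (isClosed_boundary k).preimage hs
  have h2 := (isClosed_boundary l).preimage ht
  have h3 : IsClosed {z : P × (I^ Fin (k + l)) | depth z.2 = 0} := isClosed_eq hd continuous_const
  rw [← continuousOn_univ]
  have hu : (Set.univ : Set (P × (I^ Fin (k + l)))) =
      ({z | stretch (fstBlock z.2) ∈ Cube.boundary (Fin k)} ∪
        {z | stretch (sndBlock z.2) ∈ Cube.boundary (Fin l)}) ∪ {z | depth z.2 = 0} := by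
    ext z
    by_cases hz : depth z.2 = 0
    · simp [hz]
    · simpa [hz] using stretch_boundary hz
  rw [hu]
  refine ContinuousOn.union_of_isClosed (ContinuousOn.union_of_isClosed ?_ ?_ h1 h2) ?_
    (h1.union h2) h3
  · refine ((CommutatorHSpace.leftNull.continuous.comp (hd.prodMk hgt)).continuousOn).congr
      fun z hz => ?_
    exact if_pos hz
  · refine ((CommutatorHSpace.rightNull.continuous.comp (hd.prodMk hfs)).continuousOn).congr
      fun z hz => ?_
    exact samelsonMap_right (hf' z.1) (hg' z.1) hz
  · refine ((continuous_commutator.comp (hfs.prodMk hgt)).continuousOn).congr fun z hz => ?_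
    exact samelsonMap_inner (hf' z.1) (hg' z.1) hz

/-- The Samelson product on representatives. -/
def samelsonLoop (f : GenLoop (Fin k) Y HSpace.e) (g : GenLoop (Fin l) Y HSpace.e) :
    GenLoop (Fin (k + l)) Y HSpace.e :=
  ⟨⟨fun w => samelsonMap f g w, by
    have h := continuous_samelsonMap (P := Unit)
      (f := fun z => f z.2) (g := fun z => g z.2)
      (f.1.continuous.comp continuous_snd) (g.1.continuous.comp continuous_snd)
      (fun _ => GenLoop.boundary f) (fun _ => GenLoop.boundary g)
    exact h.comp (continuous_const.prodMk continuous_id :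
      Continuous fun w : I^ Fin (k + l) => ((), w))⟩,
    fun _ hw => samelsonMap_boundary hw⟩

/-- The Samelson product `π_k(Y) × π_l(Y) → π_(k+l)(Y)`, `k, l ≥ 0`. -/
def samelson : π_ k Y (HSpace.e : Y) → π_ l Y (HSpace.e : Y) → π_ (k + l) Y (HSpace.e : Y) :=
  Quotient.map₂ samelsonLoop (by
    rintro f f' ⟨F⟩ g g' ⟨G⟩
    have hF : ∀ q, ∀ a ∈ Cube.boundary (Fin k), F (q, a) = HSpace.e := fun q a ha =>
      (F.eq_fst q ha).trans (f.2 a ha)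
    have hG : ∀ q, ∀ b ∈ Cube.boundary (Fin l), G (q, b) = HSpace.e := fun q b hb =>
      (G.eq_fst q hb).trans (g.2 b hb)
    refine ⟨⟨⟨⟨_, continuous_samelsonMap F.continuous G.continuous hF hG⟩, ?_, ?_⟩, ?_⟩⟩
    · intro w
      change samelsonMap (fun a => F (0, a)) (fun b => G (0, b)) w = samelsonMap f g w
      simp only [F.apply_zero, G.apply_zero]; rfl
    · intro w
      change samelsonMap (fun a => F (1, a)) (fun b => G (1, b)) w = samelsonMap f' g' w
      simp only [F.apply_one, G.apply_one]; rfl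
    · intro q w hw
      change samelsonMap (fun a => F (q, a)) (fun b => G (q, b)) w = samelsonMap f g w
      rw [samelsonMap_boundary hw, samelsonMap_boundary hw])

/-- The multiplication of `π_0(Y)` induced by the multiplication of the H-space `Y`. -/
def zerothMul : π_ 0 Y HSpace.e → π_ 0 Y HSpace.e → π_ 0 Y HSpace.e :=
  Quotient.map₂
    (fun f g => (⟨HSpace.hmul.comp (f.1.prodMk g.1), fun _ hz => hz.elim fun i _ => i.elim0⟩ :
      GenLoop (Fin 0) Y HSpace.e))
    (by
      rintro f f' ⟨F⟩ g g' ⟨G⟩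
      refine ⟨⟨⟨HSpace.hmul.comp (F.toContinuousMap.prodMk G.toContinuousMap), ?_, ?_⟩, ?_⟩⟩
      · intro w
        change HSpace.hmul (F (0, w), G (0, w)) = _
        rw [F.apply_zero, G.apply_zero]; rfl
      · intro w
        change HSpace.hmul (F (1, w), G (1, w)) = _
        rw [F.apply_one, G.apply_one]; rfl
      · intro _ _ hw
        exact hw.elim fun i _ => i.elim0)

/-- The map `φ_*` on homotopy groups, in all degrees `≥ 0`, is an isomorphism of graded groups
that preserves the Samelson product. The group structure in degree `0` is the one induced by the
multiplication of the H-space. -/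
structure IsSamelsonAlgebraIso {Z : Type*} [TopologicalSpace Z] [CommutatorHSpace Z]
    (φ : C(Y, Z)) (hφ : φ HSpace.e = HSpace.e) : Prop where
  bijective : ∀ n, Function.Bijective (inducedMap φ hφ n)
  map_mul : ∀ (n : ℕ) (a b : π_ (n + 1) Y HSpace.e),
    inducedMap φ hφ (n + 1) (a * b) = inducedMap φ hφ (n + 1) a * inducedMap φ hφ (n + 1) b
  map_zerothMul : ∀ a b : π_ 0 Y HSpace.e,
    inducedMap φ hφ 0 (zerothMul a b) = zerothMul (inducedMap φ hφ 0 a) (inducedMap φ hφ 0 b)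
  map_samelson : ∀ (k l : ℕ) (a : π_ k Y HSpace.e) (b : π_ l Y HSpace.e),
    inducedMap φ hφ (k + l) (samelson a b) =
      samelson (inducedMap φ hφ k a) (inducedMap φ hφ l b)

end

/-! ### Loop spaces and their products -/

/-- The loop `τ ↦ γ (ρ(r) h(τ))` with `ρ(r) = 1 - r`, for a closed curve `h` in `I` at `0`. -/
def shrink {X : Type*} [TopologicalSpace X] {x : X} (h : C(I, I)) (h0 : h 0 = 0) (h1 : h 1 = 0) :
    C(I × Path x x, Path x x) where
  toFun q :=
    { toFun := fun τ => q.2 (σ q.1 * h τ)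
      continuous_toFun := by fun_prop
      source' := by simp [h0]
      target' := by simp [h1] }
  continuous_toFun := by
    refine Path.continuous_uncurry_iff.mp ?_
    change Continuous fun z : (I × Path x x) × I => z.1.2 (σ z.1.1 * h z.2)
    fun_prop

/-- The based loop space with concatenation and reversal of loops. On `e × ΩX` the commutator map
sends `γ` to the concatenation of the constant loop, `γ`, the constant loop and the reverse of `γ`,
which is contracted by stopping at time `1 - r`; likewise on `ΩX × e`. -/
instance loopCommutatorHSpace {X : Type*} [TopologicalSpace X] (x : X) :
    CommutatorHSpace (Path x x) where
  toHSpace := inferInstance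
  inv := ⟨Path.symm, Path.continuous_symm⟩
  leftNull := shrink ⟨squareSnd, continuous_squareSnd⟩ squareSnd_zero squareSnd_one
  rightNull := shrink ⟨squareFst, continuous_squareFst⟩ squareFst_zero squareFst_one
  leftNull_zero γ := by
    ext τ
    change γ (σ 0 * squareSnd τ) = _
    rw [unitInterval.symm_zero, one_mul]
    simp only [HSpace.hmul, HSpace.e, ContinuousMap.coe_mk, Path.trans_apply, Path.refl_apply,
      Path.symm_apply]
    split_ifs with h1 h2 h2
    · have h : squareSnd τ = 0 :=
        Set.projIcc_of_le_left _ (min_le_of_left_le (by linarith))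
      rw [h, γ.source]
    · refine congrArg γ (Subtype.ext ?_)
      change ((Set.projIcc 0 1 zero_le_one _ : I) : ℝ) = _
      have h : min (4 * (τ : ℝ) - 1) (4 - 4 * (τ : ℝ)) = 4 * (τ : ℝ) - 1 :=
        min_eq_left (by linarith)
      rw [Set.coe_projIcc, h, min_eq_right (by linarith), max_eq_right (by linarith)]
      ring
    · have h : squareSnd τ = 1 :=
        Set.projIcc_of_right_le _ (le_min (by linarith) (by linarith))
      rw [h, γ.target]; rfl
    · refine congrArg γ (Subtype.ext ?_)
      change ((Set.projIcc 0 1 zero_le_one _ : I) : ℝ) = 1 - (2 * (2 * (τ : ℝ) - 1) - 1)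
      have := τ.2.2
      have h : min (4 * (τ : ℝ) - 1) (4 - 4 * (τ : ℝ)) = 4 - 4 * (τ : ℝ) :=
        min_eq_right (by linarith)
      rw [Set.coe_projIcc, h, min_eq_right (by linarith), max_eq_right (by linarith)]
      ring
  leftNull_one γ := by
    ext τ; simp [shrink, HSpace.e]
  leftNull_base r := by
    ext τ; simp [shrink, HSpace.e]
  rightNull_zero γ := by
    ext τ
    change γ (σ 0 * squareFst τ) = _
    rw [unitInterval.symm_zero, one_mul]
    simp only [HSpace.hmul, HSpace.e, ContinuousMap.coe_mk, Path.trans_apply, Path.refl_apply,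
      Path.symm_apply]
    split_ifs with h1 h2 h2
    · refine congrArg γ (Subtype.ext ?_)
      change ((Set.projIcc 0 1 zero_le_one _ : I) : ℝ) = _
      have := τ.2.1
      have h : min (4 * (τ : ℝ)) (3 - 4 * (τ : ℝ)) = 4 * (τ : ℝ) := min_eq_left (by linarith)
      rw [Set.coe_projIcc, h, min_eq_right (by linarith), max_eq_right (by linarith)]
      ring
    · have h : squareFst τ = 1 :=
        Set.projIcc_of_right_le _ (le_min (by linarith) (by linarith))
      rw [h, γ.target]
    · refine congrArg γ (Subtype.ext ?_)
      change ((Set.projIcc 0 1 zero_le_one _ : I) : ℝ) = 1 - (2 * (2 * (τ : ℝ) - 1))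
      have h : min (4 * (τ : ℝ)) (3 - 4 * (τ : ℝ)) = 3 - 4 * (τ : ℝ) :=
        min_eq_right (by linarith)
      rw [Set.coe_projIcc, h, min_eq_right (by linarith), max_eq_right (by linarith)]
      ring
    · have h : squareFst τ = 0 :=
        Set.projIcc_of_le_left _ (min_le_of_right_le (by linarith))
      rw [h, γ.source]; rfl
  rightNull_one γ := by
    ext τ; simp [shrink, HSpace.e]
  rightNull_base r := by
    ext τ; simp [shrink, HSpace.e]

/-- The product, with componentwise structure. -/
instance prodCommutatorHSpace {Y Z : Type*} [TopologicalSpace Y] [TopologicalSpace Z]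
    [CommutatorHSpace Y] [CommutatorHSpace Z] : CommutatorHSpace (Y × Z) where
  toHSpace := inferInstance
  inv := CommutatorHSpace.inv.prodMap CommutatorHSpace.inv
  leftNull := ⟨fun q => (CommutatorHSpace.leftNull (q.1, q.2.1),
    CommutatorHSpace.leftNull (q.1, q.2.2)), by fun_prop⟩
  rightNull := ⟨fun q => (CommutatorHSpace.rightNull (q.1, q.2.1),
    CommutatorHSpace.rightNull (q.1, q.2.2)), by fun_prop⟩
  leftNull_zero y := Prod.ext (CommutatorHSpace.leftNull_zero y.1)
    (CommutatorHSpace.leftNull_zero y.2)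
  leftNull_one y := Prod.ext (CommutatorHSpace.leftNull_one y.1)
    (CommutatorHSpace.leftNull_one y.2)
  leftNull_base r := Prod.ext (CommutatorHSpace.leftNull_base r) (CommutatorHSpace.leftNull_base r)
  rightNull_zero y := Prod.ext (CommutatorHSpace.rightNull_zero y.1)
    (CommutatorHSpace.rightNull_zero y.2)
  rightNull_one y := Prod.ext (CommutatorHSpace.rightNull_one y.1)
    (CommutatorHSpace.rightNull_one y.2)
  rightNull_base r := Prod.ext (CommutatorHSpace.rightNull_base r)
    (CommutatorHSpace.rightNull_base r)

/-! ### The fibre, the brace product and the splitting map -/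

section

variable {E B : Type*} [TopologicalSpace E] [TopologicalSpace B]

/-- The fibre `F = p⁻¹(b₀)`. -/
abbrev Fibre (p : C(E, B)) (b₀ : B) : Type _ := {e : E // p e = b₀}

/-- The inclusion `i : F → E`. -/
def fibreIncl (p : C(E, B)) (b₀ : B) : C(Fibre p b₀, E) := ⟨Subtype.val, continuous_subtype_val⟩

variable (p : C(E, B)) {e₀ : E} {b₀ : B} (hp : p e₀ = b₀) (s : C(B, E)) (hs : s b₀ = e₀)

/-- The James brace product `{α, β}_s = (i_*)⁻¹ [s_* α, i_* β]`. -/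
def brace {k l : ℕ} (α : π_ (k + 1) B b₀) (β : π_ (l + 1) (Fibre p b₀) ⟨e₀, hp⟩) :
    π_ (k + l + 1) (Fibre p b₀) ⟨e₀, hp⟩ :=
  Function.invFun (inducedMap (y := e₀) (fibreIncl p b₀) rfl (k + l + 1))
    (whitehead (inducedMap s hs (k + 1) α) (inducedMap (fibreIncl p b₀) rfl (l + 1) β))

/-- The map `φ_s = Ωs · Ωi : ΩB × ΩF → ΩE`. -/
def splittingMap :
    C(Path b₀ b₀ × Path (⟨e₀, hp⟩ : Fibre p b₀) ⟨e₀, hp⟩, Path e₀ e₀) where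
  toFun q := (loopMap s hs q.1).trans (loopMap (y := e₀) (fibreIncl p b₀) rfl q.2)
  continuous_toFun := by fun_prop

lemma splittingMap_base : splittingMap p hp s hs HSpace.e = HSpace.e := by
  ext τ
  change ((loopMap s hs (Path.refl b₀)).trans
    (loopMap (y := e₀) (fibreIncl p b₀) rfl (Path.refl ⟨e₀, hp⟩))) τ = e₀
  rw [Path.trans_apply]
  split_ifs with h
  · exact hs
  · rfl

end

end BraceProduct

end

open scoped unitInterval Topology Topology.Homotopy

noncomputable section

namespace BraceProduct

/-! ### Groups of homotopy classes of maps into a loop space -/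

section MappingGroup

variable {W W' X Y : Type*} [TopologicalSpace W] [TopologicalSpace W'] [TopologicalSpace X]
  [TopologicalSpace Y]

/-! Taking adjoints turns the Whitehead product of `E` into the Samelson product of `ΩE`, already on
representatives (`curryLoop_whiteheadLoop`). So the brace vanishes identically iff ⟨s_*a, i_*b⟩ is
trivial for all a ∈ π_k(ΩB), b ∈ π_l(ΩF), k, l ≥ 0 (`brace_vanishes_iff`).

The brace exists because p_*[s_*α, i_*β] = [p_*s_*α, 1] = 1 and the kernel of p_* is the image of
i_* (`IsSerreFibration.mem_range_of_eq_one`). It is unique because i_* is injective: the homotopy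
section makes p_* surjective one degree higher, so the boundary map of the fibration vanishes
(`IsSerreFibration.eq_one_of_eq_one`). The same facts write each class of `ΩE` uniquely as a product
of a class from `ΩB` and one from `ΩF`, so φ_s is bijective on homotopy in every degree without any
condition on the brace (`inducedMap_splittingMap_bijective`).

The Samelson product is studied in the group of maps S^k × S^l → ΩX under pointwise concatenation.
Pulled back along the collapse S^k × S^l → S^(k+l), it becomes the commutator of the classes pulled
back along the two projections (`collapse_samelsonLoop`), and this pullback is injective
(`collapse_injective`). Hence ⟨a, b⟩ = 1 iff the two pulled back classes commute. If all mixed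
products of s-classes and i-classes vanish, the commutator of two products splits into the product
of the commutators (`commutator_mul_of_commute`), which says that φ_s preserves Samelson products;
multiplicativity on π_0 comes from the case k = l = 0. Conversely ⟨(a,1), (1,b)⟩ = 1 in ΩB × ΩF, so
preservation forces ⟨s_*a, i_*b⟩ = 1.

Spheres are modelled by cubes with a relation that identifies boundary points, so no quotient space
is formed, and the group laws are those of the fundamental group of a mapping space. Degree 0, where
the boundary of the cube is empty, is covered by the same arguments. -/

/-- The continuous maps `W → X` that are compatible with the relation `R` and take the value `x`
on `A`. -/
def MapSet (R : W → W → Prop) (A : Set W) (x : X) : Set C(W, X) :=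
  {h | (∀ w w', R w w' → h w = h w') ∧ ∀ w ∈ A, h w = x}

lemma const_mem_mapSet (R : W → W → Prop) (A : Set W) (x : X) :
    ContinuousMap.const W x ∈ MapSet R A x :=
  ⟨fun _ _ _ => rfl, fun _ _ => rfl⟩

/-- The constant map as a point of `MapSet R A x`. -/
def mapSetConst (R : W → W → Prop) (A : Set W) (x : X) : MapSet R A x :=
  ⟨ContinuousMap.const W x, const_mem_mapSet R A x⟩

/-- The fundamental group of the space `MapSet R A x`, based at the constant map. -/
abbrev MapGroup (R : W → W → Prop) (A : Set W) (x : X) :=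
  FundamentalGroup (MapSet R A x) (mapSetConst R A x)

/-- A compatible map into the loop space as a loop of compatible maps. -/
def mapSetPath {R : W → W → Prop} {A : Set W} {x : X} (F : MapSet R A (Path.refl x)) :
    Path (mapSetConst R A x) (mapSetConst R A x) where
  toFun τ := ⟨⟨fun w => F.1 w τ, by fun_prop⟩,
    fun w w' h => by simp [F.2.1 w w' h], fun w hw => by simp [F.2.2 w hw]⟩
  continuous_toFun := by
    refine Continuous.subtype_mk ?_ _
    refine ContinuousMap.continuous_of_continuous_uncurry _ ?_
    change Continuous fun z : I × W => F.1 z.2 z.1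
    fun_prop
  source' := Subtype.ext (by ext w; simp [mapSetConst])
  target' := Subtype.ext (by ext w; simp [mapSetConst])

/-- The class of a compatible map into the loop space. -/
def mapClass {R : W → W → Prop} {A : Set W} {x : X} (F : MapSet R A (Path.refl x)) :
    MapGroup R A x :=
  FundamentalGroup.fromPath (Path.Homotopic.Quotient.mk (mapSetPath F))

variable {R : W → W → Prop} {A : Set W} {R' : W' → W' → Prop} {A' : Set W'} {x : X} {y : Y}

/-- Exchanging the parameters turns a homotopy through compatible maps into a homotopy of loops in
`MapSet R A x`; its ends stay fixed because every `K (t, w)` is a based loop. -/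
lemma mapClass_eq {F G : MapSet R A (Path.refl x)} (K : C(I × W, Path x x))
    (h0 : ∀ w, K (0, w) = F.1 w) (h1 : ∀ w, K (1, w) = G.1 w)
    (hR : ∀ t w w', R w w' → K (t, w) = K (t, w')) (hA : ∀ t, ∀ w ∈ A, K (t, w) = Path.refl x) :
    mapClass F = mapClass G := by
  refine Path.Homotopic.Quotient.eq.2 ⟨⟨⟨⟨fun q => ⟨⟨fun w => K (q.1, w) q.2, by fun_prop⟩,
    fun w w' h => by simp [hR _ w w' h], fun w hw => by simp [hA _ w hw]⟩, ?_⟩, ?_, ?_⟩, ?_⟩⟩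
  · refine Continuous.subtype_mk ?_ _
    refine ContinuousMap.continuous_of_continuous_uncurry _ ?_
    change Continuous fun z : (I × I) × W => K (z.1.1, z.2) z.1.2
    fun_prop
  · intro τ
    refine Subtype.ext (ContinuousMap.ext fun w => ?_)
    change K (0, w) τ = F.1 w τ
    rw [h0]
  · intro τ
    refine Subtype.ext (ContinuousMap.ext fun w => ?_)
    change K (1, w) τ = G.1 w τ
    rw [h1]
  · intro t τ hτ
    refine Subtype.ext (ContinuousMap.ext fun w => ?_)
    change K (t, w) τ = F.1 w τ
    rcases hτ with rfl | rfl
    · rw [Path.source, Path.source]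
    · rw [Path.target, Path.target]

/-- Local compactness of `W` makes evaluation continuous, so a homotopy of loops of maps can be
uncurried. -/
lemma mapClass_exact [LocallyCompactSpace W] {F G : MapSet R A (Path.refl x)}
    (h : mapClass F = mapClass G) :
    ∃ K : C(I × W, Path x x), (∀ w, K (0, w) = F.1 w) ∧ (∀ w, K (1, w) = G.1 w) ∧
      (∀ t w w', R w w' → K (t, w) = K (t, w')) ∧ ∀ t, ∀ w ∈ A, K (t, w) = Path.refl x := by
  obtain ⟨H⟩ := Path.Homotopic.Quotient.eq.1 h
  have hs : ∀ t w, (H (t, 0)).1 w = x := fun t w => by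
    rw [H.source]; rfl
  have ht : ∀ t w, (H (t, 1)).1 w = x := fun t w => by
    rw [H.target]; rfl
  refine ⟨⟨fun z => ⟨⟨fun τ => (H (z.1, τ)).1 z.2, ?_⟩, hs _ _, ht _ _⟩, ?_⟩, ?_, ?_, ?_, ?_⟩
  · fun_prop
  · refine Path.continuous_uncurry_iff.mp ?_
    change Continuous fun q : (I × W) × I => (H (q.1.1, q.2)).1 q.1.2
    fun_prop
  · intro w
    ext τ
    change (H (0, τ)).1 w = _
    rw [H.apply_zero]; rfl
  · intro w
    ext τ
    change (H (1, τ)).1 w = _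
    rw [H.apply_one]; rfl
  · intro t w w' hw
    ext τ
    exact (H (t, τ)).2.1 w w' hw
  · intro t w hw
    ext τ
    exact (H (t, τ)).2.2 w hw

lemma mapClass_surjective [LocallyCompactSpace W] (a : MapGroup R A x) :
    ∃ F : MapSet R A (Path.refl x), mapClass F = a := by
  obtain ⟨γ, rfl⟩ := Path.Homotopic.Quotient.mk_surjective a
  refine ⟨⟨⟨fun w => ⟨⟨fun τ => (γ τ).1 w, ?_⟩, ?_, ?_⟩, ?_⟩, ?_, ?_⟩, ?_⟩
  · fun_prop
  · exact congrArg (fun z : MapSet R A x => z.1 w) γ.source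
  · exact congrArg (fun z : MapSet R A x => z.1 w) γ.target
  · refine Path.continuous_uncurry_iff.mp ?_
    change Continuous fun q : W × I => (γ q.2).1 q.1
    fun_prop
  · intro w w' hw
    ext τ
    exact (γ τ).2.1 w w' hw
  · intro w hw
    ext τ
    exact (γ τ).2.2 w hw
  · rfl

/-- The pointwise concatenation. -/
def mapSetTrans (F G : MapSet R A (Path.refl x)) : MapSet R A (Path.refl x) :=
  ⟨⟨fun w => (F.1 w).trans (G.1 w), by fun_prop⟩,
    fun w w' h => by simp [F.2.1 w w' h, G.2.1 w w' h],
    fun w hw => by simp [F.2.2 w hw, G.2.2 w hw]⟩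

/-- The pointwise reversal. -/
def mapSetSymm (F : MapSet R A (Path.refl x)) : MapSet R A (Path.refl x) :=
  ⟨⟨fun w => (F.1 w).symm, Path.continuous_symm.comp F.1.continuous⟩,
    fun w w' h => by simp [F.2.1 w w' h], fun w hw => by simp [F.2.2 w hw]⟩

/-- Multiplication in `FundamentalGroup` is opposite to concatenation of paths. All later group
words are reversed for this reason. -/
lemma mapClass_trans (F G : MapSet R A (Path.refl x)) :
    mapClass (mapSetTrans F G) = mapClass G * mapClass F := by
  rw [FundamentalGroup.mul_def]
  refine Eq.trans ?_ (Path.Homotopic.Quotient.mk_trans _ _)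
  refine congrArg Path.Homotopic.Quotient.mk (?_ : mapSetPath (mapSetTrans F G) = _)
  ext τ w
  simp only [mapSetPath, mapSetTrans, Path.trans_apply, Path.coe_mk_mk, ContinuousMap.coe_mk]
  split_ifs <;> rfl

lemma mapClass_symm (F : MapSet R A (Path.refl x)) :
    mapClass (mapSetSymm F) = (mapClass F)⁻¹ := by
  rw [FundamentalGroup.inv_def]
  exact Path.Homotopic.Quotient.mk_symm (mapSetPath F)

lemma mapClass_const : mapClass (mapSetConst R A (Path.refl x)) = 1 := rfl

/-- Precomposition with a compatible map. -/
def mapSetPull (θ : C(W', W)) (hR : ∀ w w', R' w w' → R (θ w) (θ w')) (hA : ∀ w ∈ A', θ w ∈ A)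
    (F : MapSet R A x) : MapSet R' A' x :=
  ⟨F.1.comp θ, fun w w' h => F.2.1 _ _ (hR w w' h), fun w hw => F.2.2 _ (hA w hw)⟩

/-- The homomorphism induced by precomposition with a compatible map. -/
def mapGroupPull (θ : C(W', W)) (hR : ∀ w w', R' w w' → R (θ w) (θ w'))
    (hA : ∀ w ∈ A', θ w ∈ A) : MapGroup R A x →* MapGroup R' A' x :=
  FundamentalGroup.map ⟨mapSetPull θ hR hA, by
    refine Continuous.subtype_mk ?_ _
    exact (ContinuousMap.continuous_precomp θ).comp continuous_subtype_val⟩ _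

lemma mapGroupPull_mapClass (θ : C(W', W)) (hR : ∀ w w', R' w w' → R (θ w) (θ w'))
    (hA : ∀ w ∈ A', θ w ∈ A) (F : MapSet R A (Path.refl x)) :
    mapGroupPull θ hR hA (mapClass F) = mapClass (mapSetPull θ hR hA F) := rfl

/-- Postcomposition of compatible maps with a based map. -/
def mapSetPush (f : C(X, Y)) (hf : f x = y) (F : MapSet R A x) : MapSet R A y :=
  ⟨f.comp F.1, fun w w' h => congrArg f (F.2.1 w w' h),
    fun w hw => (congrArg f (F.2.2 w hw)).trans hf⟩

lemma loopMap_refl (f : C(X, Y)) (hf : f x = y) :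
    loopMap f hf (Path.refl x) = Path.refl y := by
  ext; exact hf

/-- The homomorphism induced by a based map. -/
def mapGroupPush (f : C(X, Y)) (hf : f x = y) : MapGroup R A x →* MapGroup R A y :=
  FundamentalGroup.mapOfEq (x := mapSetConst R A x) (y := mapSetConst R A y)
    ⟨mapSetPush f hf, by
    refine Continuous.subtype_mk ?_ _
    exact (ContinuousMap.continuous_postcomp f).comp continuous_subtype_val⟩
    (Subtype.ext (by ext w; exact hf))

lemma mapGroupPush_mapClass (f : C(X, Y)) (hf : f x = y) (F : MapSet R A (Path.refl x)) :
    mapGroupPush f hf (mapClass F) =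
      mapClass (mapSetPush (loopMap f hf) (loopMap_refl f hf) F) := by
  unfold mapGroupPush
  rw [FundamentalGroup.mapOfEq_apply]
  rfl

end MappingGroup

/-! ### Classes on spheres and on products of two spheres -/

section Spheres

variable {X : Type*} [TopologicalSpace X] {x : X} {k l n : ℕ}

/-- The relation on the cube that identifies the points of the boundary. -/
def sphereRel (n : ℕ) (u u' : I^ Fin n) : Prop :=
  u = u' ∨ (u ∈ Cube.boundary (Fin n) ∧ u' ∈ Cube.boundary (Fin n))

/-- The product relation on `I^k × I^l`. -/
def pairRel (k l : ℕ) (z z' : (I^ Fin k) × (I^ Fin l)) : Prop :=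
  sphereRel k z.1 z'.1 ∧ sphereRel l z.2 z'.2

/-- The product of the boundaries. -/
def pairBase (k l : ℕ) : Set ((I^ Fin k) × (I^ Fin l)) :=
  Cube.boundary (Fin k) ×ˢ Cube.boundary (Fin l)

/-- A generalized loop as a compatible map. -/
def sphereMapSet (f : GenLoop (Fin n) X x) :
    MapSet (sphereRel n) (Cube.boundary (Fin n)) x :=
  ⟨f.1, fun w w' h => by
    rcases h with rfl | ⟨h, h'⟩
    · rfl
    · exact (f.2 w h).trans (f.2 w' h').symm, f.2⟩

/-- The class of a generalized loop in `ΩX` in the fundamental group of `Ω^n X`. -/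
def sphereClass (f : GenLoop (Fin n) (Path x x) (Path.refl x)) :
    MapGroup (sphereRel n) (Cube.boundary (Fin n)) x :=
  mapClass (sphereMapSet f)

lemma sphereClass_surjective (a : MapGroup (sphereRel n) (Cube.boundary (Fin n)) x) :
    ∃ f : GenLoop (Fin n) (Path x x) (Path.refl x), sphereClass f = a := by
  obtain ⟨F, rfl⟩ := mapClass_surjective a
  exact ⟨⟨F.1, F.2.2⟩, rfl⟩

lemma sphereClass_eq_of_homotopy {f g : GenLoop (Fin n) (Path x x) (Path.refl x)}
    (K : C(I × (I^ Fin n), Path x x)) (h0 : ∀ w, K (0, w) = f w) (h1 : ∀ w, K (1, w) = g w)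
    (hA : ∀ t, ∀ w ∈ Cube.boundary (Fin n), K (t, w) = Path.refl x) :
    sphereClass f = sphereClass g := by
  refine mapClass_eq K h0 h1 (fun t w w' h => ?_) hA
  rcases h with rfl | ⟨h, h'⟩
  · rfl
  · exact (hA t w h).trans (hA t w' h').symm

/-- Compatibility with `sphereRel` costs nothing for homotopies that are constant on the boundary,
so both sides describe the same homotopies. -/
lemma sphereClass_eq_iff {f g : GenLoop (Fin n) (Path x x) (Path.refl x)} :
    sphereClass f = sphereClass g ↔
      (⟦f⟧ : π_ n (Path x x) (Path.refl x)) = ⟦g⟧ := by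
  constructor
  · intro h
    obtain ⟨K, h0, h1, -, hA⟩ := mapClass_exact h
    refine Quotient.sound ⟨⟨⟨K, h0, h1⟩, fun t w hw => ?_⟩⟩
    exact (hA t w hw).trans (f.2 w hw).symm
  · intro h
    obtain ⟨H⟩ := Quotient.exact h
    exact sphereClass_eq_of_homotopy H.toContinuousMap H.apply_zero H.apply_one
      fun t w hw => (H.eq_fst t hw).trans (f.2 w hw)

lemma continuous_append :
    Continuous fun z : (I^ Fin k) × (I^ Fin l) => (Fin.append z.1 z.2 : I^ Fin (k + l)) := by
  refine continuous_pi fun i => ?_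
  refine Fin.addCases (fun j => ?_) (fun j => ?_) i
  · simp only [Fin.append_left]; fun_prop
  · simp only [Fin.append_right]; fun_prop

lemma append_mem_boundary {u : I^ Fin k} {v : I^ Fin l}
    (h : u ∈ Cube.boundary (Fin k) ∨ v ∈ Cube.boundary (Fin l)) :
    (Fin.append u v : I^ Fin (k + l)) ∈ Cube.boundary (Fin (k + l)) := by
  rcases h with ⟨i, hi⟩ | ⟨i, hi⟩
  · exact ⟨Fin.castAdd l i, by simpa using hi⟩
  · exact ⟨Fin.natAdd k i, by simpa using hi⟩

lemma fstBlock_append (u : I^ Fin k) (v : I^ Fin l) :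
    fstBlock (Fin.append u v : I^ Fin (k + l)) = u := by
  ext i; simp [fstBlock]

lemma sndBlock_append (u : I^ Fin k) (v : I^ Fin l) :
    sndBlock (Fin.append u v : I^ Fin (k + l)) = v := by
  ext i; simp [sndBlock]

lemma append_blocks (w : I^ Fin (k + l)) :
    (Fin.append (fstBlock w) (sndBlock w) : I^ Fin (k + l)) = w := by
  funext i
  refine Fin.addCases (fun j => ?_) (fun j => ?_) i
  · rw [Fin.append_left]; rfl
  · rw [Fin.append_right]; rfl

/-- The two blocks are changed one after the other, through the intermediate point `(u', v)`. -/
lemma eq_of_pairRel {Y : Type*} {c : (I^ Fin k) × (I^ Fin l) → Y}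
    (h1 : ∀ u ∈ Cube.boundary (Fin k), ∀ u' ∈ Cube.boundary (Fin k), ∀ v, c (u, v) = c (u', v))
    (h2 : ∀ v ∈ Cube.boundary (Fin l), ∀ v' ∈ Cube.boundary (Fin l), ∀ u, c (u, v) = c (u, v'))
    {z z' : (I^ Fin k) × (I^ Fin l)} (h : pairRel k l z z') : c z = c z' := by
  obtain ⟨u, v⟩ := z
  obtain ⟨u', v'⟩ := z'
  obtain ⟨hu, hv⟩ := h
  have e1 : c (u, v) = c (u', v) := by
    rcases hu with hu | hu
    · exact congrArg (fun a => c (a, v)) hu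
    · exact h1 _ hu.1 _ hu.2 _
  have e2 : c (u', v) = c (u', v') := by
    rcases hv with hv | hv
    · exact congrArg (fun a => c (u', a)) hv
    · exact h2 _ hv.1 _ hv.2 _
  exact e1.trans e2

lemma pairRel_append {z z' : (I^ Fin k) × (I^ Fin l)} (h : pairRel k l z z') :
    sphereRel (k + l) (Fin.append z.1 z.2) (Fin.append z'.1 z'.2) := by
  rcases h.1 with hu | hu
  · rcases h.2 with hv | hv
    · left; rw [hu, hv]
    · exact Or.inr ⟨append_mem_boundary (Or.inr hv.1), append_mem_boundary (Or.inr hv.2)⟩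
  · exact Or.inr ⟨append_mem_boundary (Or.inl hu.1), append_mem_boundary (Or.inl hu.2)⟩

/-- The homomorphism induced by the collapse `S^k × S^l → S^(k+l)`. -/
def collapse (k l : ℕ) (x : X) :
    MapGroup (sphereRel (k + l)) (Cube.boundary (Fin (k + l))) x →*
      MapGroup (pairRel k l) (pairBase k l) x :=
  mapGroupPull ⟨_, continuous_append⟩ (fun _ _ h => pairRel_append h)
    (fun _ h => append_mem_boundary (Or.inl h.1))

/-- The homomorphism induced by the projection `S^k × S^l → S^k`. -/
def pullFst (k l : ℕ) (x : X) :
    MapGroup (sphereRel k) (Cube.boundary (Fin k)) x →*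
      MapGroup (pairRel k l) (pairBase k l) x :=
  mapGroupPull ⟨_, continuous_fst⟩ (fun _ _ h => h.1) (fun _ h => h.1)

/-- The homomorphism induced by the projection `S^k × S^l → S^l`. -/
def pullSnd (k l : ℕ) (x : X) :
    MapGroup (sphereRel l) (Cube.boundary (Fin l)) x →*
      MapGroup (pairRel k l) (pairBase k l) x :=
  mapGroupPull ⟨_, continuous_snd⟩ (fun _ _ h => h.2) (fun _ h => h.2)

/-- The homomorphism induced by the swap `S^l × S^k → S^k × S^l`. -/
def pullSwap (k l : ℕ) (x : X) :
    MapGroup (pairRel k l) (pairBase k l) x →* MapGroup (pairRel l k) (pairBase l k) x :=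
  mapGroupPull ⟨_, continuous_swap⟩ (fun _ _ h => ⟨h.2, h.1⟩) (fun _ h => ⟨h.2, h.1⟩)

/-- The homomorphism induced by the diagonal `S^k → S^k × S^k`. -/
def pullDiag (k : ℕ) (x : X) :
    MapGroup (pairRel k k) (pairBase k k) x →*
      MapGroup (sphereRel k) (Cube.boundary (Fin k)) x :=
  mapGroupPull ⟨fun u => (u, u), by fun_prop⟩ (fun _ _ h => ⟨h, h⟩) (fun _ h => ⟨h, h⟩)

lemma pullSwap_pullFst (a : MapGroup (sphereRel k) (Cube.boundary (Fin k)) x) :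
    pullSwap k l x (pullFst k l x a) = pullSnd l k x a := by
  obtain ⟨F, rfl⟩ := mapClass_surjective a
  rfl

lemma pullSwap_pullSnd (a : MapGroup (sphereRel l) (Cube.boundary (Fin l)) x) :
    pullSwap k l x (pullSnd k l x a) = pullFst l k x a := by
  obtain ⟨F, rfl⟩ := mapClass_surjective a
  rfl

lemma pullDiag_pullFst (a : MapGroup (sphereRel k) (Cube.boundary (Fin k)) x) :
    pullDiag k x (pullFst k k x a) = a := by
  obtain ⟨F, rfl⟩ := mapClass_surjective a
  rfl

lemma pullDiag_pullSnd (a : MapGroup (sphereRel k) (Cube.boundary (Fin k)) x) :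
    pullDiag k x (pullSnd k k x a) = a := by
  obtain ⟨F, rfl⟩ := mapClass_surjective a
  rfl

end Spheres

/-! ### Gluing in the collar -/

section Collar

variable {k l n : ℕ}

/-- A homotopy from the identity to `stretch`. -/
def stretchAt (r : I) (u : I^ Fin n) : I^ Fin n :=
  fun i => Set.projIcc 0 1 zero_le_one ((1 + 2 * (r : ℝ)) * (u i : ℝ) - r)

/-- The depth in the collar of `stretchAt r`. -/
def depthAt (r : I) (u : I^ Fin n) : I :=
  Finset.univ.sup fun i => Set.projIcc 0 1 zero_le_one
    (max (r - (1 + 2 * (r : ℝ)) * (u i : ℝ)) ((1 + 2 * (r : ℝ)) * (u i : ℝ) - (1 + r)))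

lemma continuous_stretchAt : Continuous fun z : I × (I^ Fin n) => stretchAt z.1 z.2 := by
  unfold stretchAt
  refine continuous_pi fun i => continuous_projIcc.comp ?_
  fun_prop

lemma continuous_depthAt : Continuous fun z : I × (I^ Fin n) => depthAt z.1 z.2 := by
  unfold depthAt
  refine Continuous.finset_sup_apply fun i _ => continuous_projIcc.comp ?_
  fun_prop

lemma stretchAt_zero (u : I^ Fin n) : stretchAt 0 u = u := by
  funext i
  simp [stretchAt]

lemma stretchAt_one (u : I^ Fin n) : stretchAt 1 u = stretch u := by
  funext i
  unfold stretchAt stretch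
  congr 2
  simp; norm_num

lemma depthAt_zero (u : I^ Fin n) : depthAt 0 u = 0 := by
  refine le_antisymm (Finset.sup_le fun i _ => le_of_eq ?_) unitInterval.nonneg'
  refine Set.projIcc_of_le_left _ (max_le ?_ ?_)
  · simpa using (u i).2.1
  · simpa using (u i).2.2

lemma depthAt_one (u : I^ Fin n) : depthAt 1 u = depth u := by
  unfold depthAt depth
  congr 1
  funext i
  congr 2
  · simp; norm_num
  · simp; norm_num

lemma stretchAt_mem_boundary (r : I) {u : I^ Fin n} (hu : u ∈ Cube.boundary (Fin n)) :
    stretchAt r u ∈ Cube.boundary (Fin n) := by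
  obtain ⟨i, hi⟩ := hu
  refine ⟨i, ?_⟩
  have := r.2.1
  rcases hi with hi | hi
  · left
    refine Set.projIcc_of_le_left _ ?_
    rw [hi]; simpa using this
  · right
    refine Set.projIcc_of_right_le _ ?_
    rw [hi]; simp; linarith

/-- At coordinate 0 the first term of the maximum is r, at coordinate 1 the second is (1 + 2r) - (1
+ r) = r, and neither ever exceeds r. So on the boundary a collar null-homotopy has run exactly up
to time r. -/
lemma depthAt_boundary (r : I) {u : I^ Fin n} (hu : u ∈ Cube.boundary (Fin n)) :
    depthAt r u = r := by
  have hr := r.2.1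
  refine le_antisymm (Finset.sup_le fun i _ => ?_) ?_
  · refine le_trans ?_ (Set.projIcc_val zero_le_one r).le
    refine Set.monotone_projIcc _ (max_le ?_ ?_)
    · have := mul_nonneg (by linarith : 0 ≤ 1 + 2 * (r : ℝ)) (u i).2.1
      linarith
    · have := mul_le_mul_of_nonneg_left (u i).2.2 (by linarith : 0 ≤ 1 + 2 * (r : ℝ))
      linarith
  · obtain ⟨i, hi⟩ := hu
    refine le_trans ?_ (Finset.le_sup (Finset.mem_univ i))
    conv_lhs => rw [← Set.projIcc_val zero_le_one r]
    refine Set.monotone_projIcc _ ?_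
    rcases hi with hi | hi <;> rw [hi]
    · simp
    · refine le_max_of_le_right ?_
      simp; linarith

lemma stretchAt_mem_of_depthAt {r : I} {w : I^ Fin (k + l)} (hw : depthAt r w ≠ 0) :
    stretchAt r (fstBlock w) ∈ Cube.boundary (Fin k) ∨
      stretchAt r (sndBlock w) ∈ Cube.boundary (Fin l) := by
  have key : ∃ i, 0 < r - (1 + 2 * (r : ℝ)) * (w i : ℝ) ∨
      0 < (1 + 2 * (r : ℝ)) * (w i : ℝ) - (1 + r) := by
    by_contra! hcon
    refine hw (le_antisymm ?_ unitInterval.nonneg')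
    refine Finset.sup_le fun i _ => le_of_eq ?_
    exact Set.projIcc_of_le_left _ (max_le (hcon i).1 (hcon i).2)
  obtain ⟨i, hi⟩ := key
  have hs : stretchAt r w i = 0 ∨ stretchAt r w i = 1 := by
    rcases hi with hi | hi
    · exact Or.inl (Set.projIcc_of_le_left _ (by linarith))
    · exact Or.inr (Set.projIcc_of_right_le _ (by linarith))
  revert hs
  refine Fin.addCases (fun j hs => Or.inl ⟨j, hs⟩) (fun j hs => Or.inr ⟨j, hs⟩) i

-- The sets where `u` is on the boundary, where `v` is, and where `d = 0` are closed and cover `Z`;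
-- the last three hypotheses are agreement on the overlaps.
open Classical in
lemma continuous_collar {Z Y : Type*} [TopologicalSpace Z] [TopologicalSpace Y]
    {u : Z → I^ Fin k} {v : Z → I^ Fin l} {d : Z → I} (hu : Continuous u) (hv : Continuous v)
    (hd : Continuous d) {a b c : Z → Y} (ha : Continuous a) (hb : Continuous b)
    (hc : Continuous c)
    (hcover : ∀ z, d z ≠ 0 → u z ∈ Cube.boundary (Fin k) ∨ v z ∈ Cube.boundary (Fin l))
    (hab : ∀ z, u z ∈ Cube.boundary (Fin k) → v z ∈ Cube.boundary (Fin l) → a z = b z)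
    (hac : ∀ z, u z ∈ Cube.boundary (Fin k) → d z = 0 → a z = c z)
    (hbc : ∀ z, v z ∈ Cube.boundary (Fin l) → d z = 0 → b z = c z) :
    Continuous fun z => if u z ∈ Cube.boundary (Fin k) then a z
      else if v z ∈ Cube.boundary (Fin l) then b z else c z := by
  have h1 := (isClosed_boundary k).preimage hu
  have h2 := (isClosed_boundary l).preimage hv
  have h3 : IsClosed {z | d z = 0} := isClosed_eq hd continuous_const
  rw [← continuousOn_univ]
  have hcov : (Set.univ : Set Z) =
      (u ⁻¹' Cube.boundary (Fin k) ∪ v ⁻¹' Cube.boundary (Fin l)) ∪ {z | d z = 0} := by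
    ext z
    by_cases hz : d z = 0
    · simp [hz]
    · simpa [hz] using hcover z hz
  rw [hcov]
  refine ContinuousOn.union_of_isClosed (ContinuousOn.union_of_isClosed ?_ ?_ h1 h2) ?_
    (h1.union h2) h3
  · exact ha.continuousOn.congr fun z hz => if_pos hz
  · refine hb.continuousOn.congr fun z hz => ?_
    split_ifs with h h'
    · exact hab z h hz
    · rfl
    · exact absurd hz h'
  · refine hc.continuousOn.congr fun z hz => ?_
    split_ifs with h h'
    · exact hac z h hz
    · exact hbc z h' hz
    · rfl

end Collar

/-! ### The Samelson product as a commutator -/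

section SamelsonHomotopy

variable {Y : Type*} [TopologicalSpace Y] [CommutatorHSpace Y] {k l : ℕ}

lemma leftNull_zero_eq (y : Y) :
    CommutatorHSpace.leftNull (0, y) = commutator HSpace.e y :=
  CommutatorHSpace.leftNull_zero y

lemma rightNull_zero_eq (y : Y) :
    CommutatorHSpace.rightNull (0, y) = commutator y HSpace.e :=
  CommutatorHSpace.rightNull_zero y

/-- The homotopy from the commutator map to the Samelson product on `S^k × S^l`. -/
def samelsonHomotopy (f : (I^ Fin k) → Y) (g : (I^ Fin l) → Y)
    (z : I × ((I^ Fin k) × (I^ Fin l))) : Y := by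
  classical
  exact
    if stretchAt z.1 z.2.1 ∈ Cube.boundary (Fin k) then
      CommutatorHSpace.leftNull (depthAt z.1 (Fin.append z.2.1 z.2.2 : I^ Fin (k + l)),
        g (stretchAt z.1 z.2.2))
    else if stretchAt z.1 z.2.2 ∈ Cube.boundary (Fin l) then
      CommutatorHSpace.rightNull (depthAt z.1 (Fin.append z.2.1 z.2.2 : I^ Fin (k + l)),
        f (stretchAt z.1 z.2.1))
    else commutator (f (stretchAt z.1 z.2.1)) (g (stretchAt z.1 z.2.2))

variable {f : (I^ Fin k) → Y} {g : (I^ Fin l) → Y}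

lemma continuous_samelsonHomotopy (hf : Continuous f) (hg : Continuous g)
    (hfb : ∀ u ∈ Cube.boundary (Fin k), f u = HSpace.e)
    (hgb : ∀ v ∈ Cube.boundary (Fin l), g v = HSpace.e) :
    Continuous (samelsonHomotopy f g) := by
  have hsu : Continuous fun z : I × ((I^ Fin k) × (I^ Fin l)) => stretchAt z.1 z.2.1 :=
    continuous_stretchAt.comp (continuous_fst.prodMk (continuous_fst.comp continuous_snd))
  have hsv : Continuous fun z : I × ((I^ Fin k) × (I^ Fin l)) => stretchAt z.1 z.2.2 :=
    continuous_stretchAt.comp (continuous_fst.prodMk (continuous_snd.comp continuous_snd))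
  have hd : Continuous fun z : I × ((I^ Fin k) × (I^ Fin l)) =>
      depthAt z.1 (Fin.append z.2.1 z.2.2 : I^ Fin (k + l)) :=
    continuous_depthAt.comp (continuous_fst.prodMk (continuous_append.comp continuous_snd))
  have hfs := hf.comp hsu
  have hgs := hg.comp hsv
  refine continuous_collar hsu hsv hd
    (CommutatorHSpace.leftNull.continuous.comp (hd.prodMk hgs))
    (CommutatorHSpace.rightNull.continuous.comp (hd.prodMk hfs))
    (continuous_commutator.comp (hfs.prodMk hgs)) ?_ ?_ ?_ ?_
  · intro z hz
    have := stretchAt_mem_of_depthAt hz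
    rwa [fstBlock_append, sndBlock_append] at this
  · intro z h1 h2
    rw [hfb _ h1, hgb _ h2, CommutatorHSpace.leftNull_base, CommutatorHSpace.rightNull_base]
  · intro z h1 h2
    rw [hfb _ h1, h2, leftNull_zero_eq]
  · intro z h1 h2
    rw [hgb _ h1, h2, rightNull_zero_eq]

/-- The right-hand side is free of `u`; with the analogous statement for `v` this makes the homotopy
descend to S^k × S^l. -/
lemma samelsonHomotopy_fst (t : I) {u : I^ Fin k} (hu : u ∈ Cube.boundary (Fin k))
    (v : I^ Fin l) :
    samelsonHomotopy f g (t, (u, v)) = CommutatorHSpace.leftNull (t, g (stretchAt t v)) := by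
  refine (if_pos (stretchAt_mem_boundary t hu)).trans ?_
  dsimp only
  rw [depthAt_boundary t (append_mem_boundary (Or.inl hu))]

lemma samelsonHomotopy_snd (hfb : ∀ u ∈ Cube.boundary (Fin k), f u = HSpace.e)
    (hgb : ∀ v ∈ Cube.boundary (Fin l), g v = HSpace.e) (t : I) {v : I^ Fin l}
    (hv : v ∈ Cube.boundary (Fin l)) (u : I^ Fin k) :
    samelsonHomotopy f g (t, (u, v)) = CommutatorHSpace.rightNull (t, f (stretchAt t u)) := by
  unfold samelsonHomotopy
  dsimp only
  rw [depthAt_boundary t (append_mem_boundary (Or.inr hv))]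
  split_ifs with h h'
  · rw [hgb _ (stretchAt_mem_boundary t hv), hfb _ h, CommutatorHSpace.leftNull_base,
      CommutatorHSpace.rightNull_base]
  · rfl
  · exact absurd (stretchAt_mem_boundary t hv) h'

lemma samelsonHomotopy_base (hgb : ∀ v ∈ Cube.boundary (Fin l), g v = HSpace.e) (t : I)
    {u : I^ Fin k} (hu : u ∈ Cube.boundary (Fin k)) {v : I^ Fin l}
    (hv : v ∈ Cube.boundary (Fin l)) : samelsonHomotopy f g (t, (u, v)) = HSpace.e := by
  rw [samelsonHomotopy_fst t hu, hgb _ (stretchAt_mem_boundary t hv),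
    CommutatorHSpace.leftNull_base]

lemma samelsonHomotopy_zero (hfb : ∀ u ∈ Cube.boundary (Fin k), f u = HSpace.e)
    (hgb : ∀ v ∈ Cube.boundary (Fin l), g v = HSpace.e) (u : I^ Fin k) (v : I^ Fin l) :
    samelsonHomotopy f g (0, (u, v)) = commutator (f u) (g v) := by
  unfold samelsonHomotopy
  dsimp only
  rw [stretchAt_zero, stretchAt_zero, depthAt_zero]
  split_ifs with h h'
  · rw [hfb _ h, leftNull_zero_eq]
  · rw [hgb _ h', rightNull_zero_eq]
  · rfl

lemma samelsonHomotopy_one (u : I^ Fin k) (v : I^ Fin l) :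
    samelsonHomotopy f g (1, (u, v)) = samelsonMap f g (Fin.append u v) := by
  unfold samelsonMap samelsonHomotopy
  dsimp only
  rw [stretchAt_one, stretchAt_one, depthAt_one, fstBlock_append, sndBlock_append]

end SamelsonHomotopy

section SamelsonCommutator

variable {X : Type*} [TopologicalSpace X] {x : X} {k l : ℕ}

/-- `samelsonHomotopy` widens the collar from nothing, where it is the pointwise commutator, to full
width, where it is the Samelson product after the collapse. It moves the wedge, which is allowed:
only the corner `pairBase` has to stay at the base point. -/
lemma collapse_samelsonLoop (f : GenLoop (Fin k) (Path x x) (Path.refl x))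
    (g : GenLoop (Fin l) (Path x x) (Path.refl x)) :
    collapse k l x (sphereClass (samelsonLoop f g)) =
      (pullSnd k l x (sphereClass g))⁻¹ * (pullFst k l x (sphereClass f))⁻¹ *
        (pullSnd k l x (sphereClass g) * pullFst k l x (sphereClass f)) := by
  let F : MapSet (pairRel k l) (pairBase k l) (Path.refl x) :=
    mapSetPull ⟨_, continuous_fst⟩ (fun _ _ h => h.1) (fun _ h => h.1) (sphereMapSet f)
  let G : MapSet (pairRel k l) (pairBase k l) (Path.refl x) :=
    mapSetPull ⟨_, continuous_snd⟩ (fun _ _ h => h.2) (fun _ h => h.2) (sphereMapSet g)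
  have hF : pullFst k l x (sphereClass f) = mapClass F := rfl
  have hG : pullSnd k l x (sphereClass g) = mapClass G := rfl
  rw [hF, hG, ← mapClass_symm, ← mapClass_symm, ← mapClass_trans, ← mapClass_trans,
    ← mapClass_trans]
  unfold sphereClass collapse
  rw [mapGroupPull_mapClass]
  symm
  refine mapClass_eq ⟨samelsonHomotopy f g,
    continuous_samelsonHomotopy f.1.continuous g.1.continuous f.2 g.2⟩ ?_ ?_ ?_ ?_
  · rintro ⟨u, v⟩
    exact samelsonHomotopy_zero f.2 g.2 u v
  · rintro ⟨u, v⟩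
    exact samelsonHomotopy_one u v
  · intro t z z' h
    refine eq_of_pairRel (c := fun z => samelsonHomotopy f g (t, z)) ?_ ?_ h
    · intro u hu u' hu' v
      exact (samelsonHomotopy_fst t hu v).trans (samelsonHomotopy_fst t hu' v).symm
    · intro v hv v' hv' u
      exact (samelsonHomotopy_snd f.2 g.2 t hv u).trans
        (samelsonHomotopy_snd f.2 g.2 t hv' u).symm
  · rintro t ⟨u, v⟩ ⟨hu, hv⟩
    exact samelsonHomotopy_base g.2 t hu hv

end SamelsonCommutator

/-! ### The collapse is injective -/

section CollapseInjective

variable {X Y : Type*} [TopologicalSpace X] [TopologicalSpace Y] {x : X} {k l n : ℕ}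

/-- The restriction of `c` to the axis over the base point of S^k. For k = 0 the boundary is empty
and there is no such axis; the constant map then serves as a harmless default. -/
lemma exists_axis {V : Type*} [TopologicalSpace V] {y : Y} (c : C(I × ((I^ Fin k) × V), Y))
    (hc : ∀ t, ∀ u ∈ Cube.boundary (Fin k), ∀ u' ∈ Cube.boundary (Fin k), ∀ v,
      c (t, (u, v)) = c (t, (u', v))) :
    ∃ a : C(I × V, Y), (∀ t, ∀ u ∈ Cube.boundary (Fin k), ∀ v, c (t, (u, v)) = a (t, v)) ∧
      ∀ t v, (∀ u ∈ Cube.boundary (Fin k), c (t, (u, v)) = y) → a (t, v) = y := by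
  by_cases h : (Cube.boundary (Fin k)).Nonempty
  · obtain ⟨u, hu⟩ := h
    exact ⟨c.comp ⟨fun q => (q.1, (u, q.2)), by fun_prop⟩, fun t u' hu' v => hc t u' hu' u hu v,
      fun t v h => h u hu⟩
  · exact ⟨ContinuousMap.const _ y, fun t u hu => absurd ⟨u, hu⟩ h, fun _ _ _ => rfl⟩

/-- The curve that runs from `0` to `1`, waits, and runs back. -/
def plateau : C(I, I) :=
  ⟨fun τ => Set.projIcc 0 1 zero_le_one (min (4 * (τ : ℝ)) (2 - 2 * (τ : ℝ))),
    continuous_projIcc.comp (by fun_prop)⟩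

/-- The curve that runs from `0` to `1`, runs back, and waits. -/
def tent : C(I, I) :=
  ⟨fun τ => Set.projIcc 0 1 zero_le_one (min (4 * (τ : ℝ)) (2 - 4 * (τ : ℝ))),
    continuous_projIcc.comp (by fun_prop)⟩

lemma plateau_zero : plateau 0 = 0 :=
  Set.projIcc_of_le_left zero_le_one (min_le_of_left_le (by norm_num))

lemma plateau_one : plateau 1 = 0 :=
  Set.projIcc_of_le_left zero_le_one (min_le_of_right_le (by norm_num))

lemma tent_zero : tent 0 = 0 :=
  Set.projIcc_of_le_left zero_le_one (min_le_of_left_le (by norm_num))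

lemma tent_one : tent 1 = 0 :=
  Set.projIcc_of_le_left zero_le_one (min_le_of_right_le (by norm_num))

lemma shrink_refl (h : C(I, I)) (h0 : h 0 = 0) (h1 : h 1 = 0) (r : I) :
    shrink h h0 h1 (r, Path.refl x) = Path.refl x := by
  ext; simp [shrink]

lemma shrink_one (h : C(I, I)) (h0 : h 0 = 0) (h1 : h 1 = 0) (γ : Path x x) :
    shrink h h0 h1 (1, γ) = Path.refl x := by
  ext; simp [shrink]

lemma path_projIcc_eq (γ : Path x x) {s : ℝ} {t : I} (h : max 0 (min 1 s) = t) :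
    γ (Set.projIcc 0 1 zero_le_one s) = γ t :=
  congrArg γ (Subtype.ext ((Set.coe_projIcc _ _ _ _).trans h))

/-- This loop is the value of the corrected homotopy in `collapse_injective` where the first block
is on the boundary; the shrinking contracts it to the base point. -/
lemma shrink_plateau_zero (γ : Path x x) :
    shrink plateau plateau_zero plateau_one (0, γ) = (γ.trans (Path.refl x)).trans γ.symm := by
  ext τ
  change γ (σ 0 * plateau τ) = _
  rw [unitInterval.symm_zero, one_mul]
  simp only [Path.trans_apply, Path.refl_apply, Path.symm_apply]
  have h0 := τ.2.1
  have h1 := τ.2.2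
  split_ifs with h2 h3
  · refine path_projIcc_eq γ ?_
    rw [min_eq_left (by linarith : 4 * (τ : ℝ) ≤ 2 - 2 * τ), min_eq_right (by linarith),
      max_eq_right (by linarith)]
    ring
  · refine (path_projIcc_eq (t := 1) γ ?_).trans γ.target
    rw [min_eq_left (le_min (by linarith) (by linarith))]
    simp
  · refine path_projIcc_eq γ ?_
    change _ = 1 - (2 * (τ : ℝ) - 1)
    rw [min_eq_right (by linarith : 2 - 2 * τ ≤ 4 * (τ : ℝ)), min_eq_right (by linarith),
      max_eq_right (by linarith)]
    ring

/-- The counterpart for the second block. The waiting interval sits elsewhere because the trivial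
factor does. -/
lemma shrink_tent_zero (γ : Path x x) :
    shrink tent tent_zero tent_one (0, γ) = (γ.trans γ.symm).trans (Path.refl x) := by
  ext τ
  change γ (σ 0 * tent τ) = _
  rw [unitInterval.symm_zero, one_mul]
  simp only [Path.trans_apply, Path.refl_apply, Path.symm_apply]
  have h0 := τ.2.1
  have h1 := τ.2.2
  split_ifs with h2 h3
  · refine path_projIcc_eq γ ?_
    rw [min_eq_left (by linarith : 4 * (τ : ℝ) ≤ 2 - 4 * τ), min_eq_right (by linarith),
      max_eq_right (by linarith)]
    ring
  · refine path_projIcc_eq γ ?_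
    change _ = 1 - (2 * (2 * (τ : ℝ)) - 1)
    rw [min_eq_right (by linarith : 2 - 4 * τ ≤ 4 * (τ : ℝ)), min_eq_right (by linarith),
      max_eq_right (by linarith)]
    ring
  · refine (path_projIcc_eq (t := 0) γ ?_).trans γ.source
    rw [min_eq_right (by linarith : 2 - 4 * τ ≤ 4 * (τ : ℝ)), min_eq_right (by linarith),
      max_eq_left (by linarith)]
    simp

/-- The loop `h ∘ stretch`, followed by two constant loops. -/
def stretchPad (h : GenLoop (Fin n) (Path x x) (Path.refl x)) :
    GenLoop (Fin n) (Path x x) (Path.refl x) :=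
  ⟨⟨fun w => ((h (stretch w)).trans (Path.refl x)).trans (Path.refl x), by
    have hs : Continuous fun w => h (stretch w) := h.1.continuous.comp continuous_stretch
    have hr : Continuous fun _ : I^ Fin n => Path.refl x := continuous_const
    exact Path.continuous_trans.comp
      ((Path.continuous_trans.comp (hs.prodMk hr)).prodMk hr)⟩, fun w hw => by
    have : h (stretch w) = Path.refl x := by
      rw [← stretchAt_one]; exact h.2 _ (stretchAt_mem_boundary 1 hw)
    simp [this]⟩

/-- The ends of the homotopy in `collapse_injective` have this form. Padding multiplies by 1, and
`stretchAt` deforms the rescaling away. -/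
lemma sphereClass_stretchPad (h : GenLoop (Fin n) (Path x x) (Path.refl x)) :
    sphereClass (stretchPad h) = sphereClass h := by
  let h' : GenLoop (Fin n) (Path x x) (Path.refl x) :=
    ⟨⟨fun w => h (stretch w), h.1.continuous.comp continuous_stretch⟩, fun w hw => by
      change h (stretch w) = _
      rw [← stretchAt_one]; exact h.2 _ (stretchAt_mem_boundary 1 hw)⟩
  have h1 : sphereClass (stretchPad h) = sphereClass h' := by
    have : sphereClass (stretchPad h) = mapClass (mapSetTrans (mapSetTrans (sphereMapSet h')
      (mapSetConst _ _ _)) (mapSetConst _ _ _)) := rfl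
    rw [this, mapClass_trans, mapClass_trans, mapClass_const, one_mul, one_mul]
    rfl
  rw [h1]
  refine (sphereClass_eq_of_homotopy
    ⟨fun z => h (stretchAt z.1 z.2), h.1.continuous.comp continuous_stretchAt⟩ ?_ ?_ ?_).symm
  · intro w
    change h (stretchAt 0 w) = _
    rw [stretchAt_zero]
  · intro w
    change h (stretchAt 1 w) = h (stretch w)
    rw [stretchAt_one]
  · intro t w hw
    exact h.2 _ (stretchAt_mem_boundary t hw)

/-- A homotopy `c` on S^k × S^l between maps that factor through S^(k+l) need not be trivial on the
wedge. Dividing pointwise by its restrictions `q` and `p` to the two axes makes it null-homotopic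
there by explicit contractions, which are inserted in the collar. The result is a homotopy relative
to the boundary of I^(k+l). -/
lemma collapse_injective (k l : ℕ) (x : X) : Function.Injective (collapse k l x) := by
  classical
  intro a a' haa
  obtain ⟨h, rfl⟩ := sphereClass_surjective a
  obtain ⟨h', rfl⟩ := sphereClass_surjective a'
  unfold sphereClass collapse at haa
  rw [mapGroupPull_mapClass, mapGroupPull_mapClass] at haa
  obtain ⟨c, hc0, hc1, hcR, hcA⟩ := mapClass_exact haa
  have hc0' : ∀ u v, c (0, (u, v)) = h (Fin.append u v) := fun u v => hc0 (u, v)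
  have hc1' : ∀ u v, c (1, (u, v)) = h' (Fin.append u v) := fun u v => hc1 (u, v)
  have hcu : ∀ t, ∀ u ∈ Cube.boundary (Fin k), ∀ u' ∈ Cube.boundary (Fin k), ∀ v,
      c (t, (u, v)) = c (t, (u', v)) := fun t u hu u' hu' v =>
    hcR t _ _ ⟨Or.inr ⟨hu, hu'⟩, Or.inl rfl⟩
  have hcv : ∀ t, ∀ v ∈ Cube.boundary (Fin l), ∀ v' ∈ Cube.boundary (Fin l), ∀ u,
      c (t, (u, v)) = c (t, (u, v')) := fun t v hv v' hv' u =>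
    hcR t _ _ ⟨Or.inl rfl, Or.inr ⟨hv, hv'⟩⟩
  have hcb : ∀ t, ∀ u ∈ Cube.boundary (Fin k), ∀ v ∈ Cube.boundary (Fin l),
      c (t, (u, v)) = Path.refl x := fun t u hu v hv => hcA t (u, v) ⟨hu, hv⟩
  obtain ⟨p, hp1, hp2⟩ := exists_axis (y := Path.refl x) c hcu
  obtain ⟨q, hq1, hq2⟩ := exists_axis (y := Path.refl x)
    (c.comp ⟨fun z : I × ((I^ Fin l) × (I^ Fin k)) => (z.1, (z.2.2, z.2.1)), by fun_prop⟩)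
    (fun t v hv v' hv' u => hcv t v hv v' hv' u)
  replace hq1 : ∀ t, ∀ v ∈ Cube.boundary (Fin l), ∀ u, c (t, (u, v)) = q (t, u) := hq1
  replace hq2 : ∀ t u, (∀ v ∈ Cube.boundary (Fin l), c (t, (u, v)) = Path.refl x) →
    q (t, u) = Path.refl x := hq2
  have hpb : ∀ t, ∀ v ∈ Cube.boundary (Fin l), p (t, v) = Path.refl x := fun t v hv =>
    hp2 t v fun u hu => hcb t u hu v hv
  have hqb : ∀ t, ∀ u ∈ Cube.boundary (Fin k), q (t, u) = Path.refl x := fun t u hu =>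
    hq2 t u fun v hv => hcb t u hu v hv
  have hsu : Continuous fun z : I × (I^ Fin (k + l)) => stretch (fstBlock z.2) :=
    continuous_stretch.comp (continuous_fstBlock.comp continuous_snd)
  have hsv : Continuous fun z : I × (I^ Fin (k + l)) => stretch (sndBlock z.2) :=
    continuous_stretch.comp (continuous_sndBlock.comp continuous_snd)
  have hd : Continuous fun z : I × (I^ Fin (k + l)) => depth z.2 :=
    continuous_depth.comp continuous_snd
  have hps : Continuous fun z : I × (I^ Fin (k + l)) => p (z.1, stretch (sndBlock z.2)) :=
    p.continuous.comp (continuous_fst.prodMk hsv)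
  have hqs : Continuous fun z : I × (I^ Fin (k + l)) => q (z.1, stretch (fstBlock z.2)) :=
    q.continuous.comp (continuous_fst.prodMk hsu)
  have hcs : Continuous fun z : I × (I^ Fin (k + l)) =>
      c (z.1, (stretch (fstBlock z.2), stretch (sndBlock z.2))) :=
    c.continuous.comp (continuous_fst.prodMk (hsu.prodMk hsv))
  -- The corrected homotopy is c · q⁻¹ · p⁻¹. With the first block on the boundary it reads (p · 1)
  -- · p⁻¹, with the second one (q · q⁻¹) · 1, the loops contracted by `plateau` and `tent`.
  let K : C(I × (I^ Fin (k + l)), Path x x) :=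
    ⟨fun z => if stretch (fstBlock z.2) ∈ Cube.boundary (Fin k) then
        shrink plateau plateau_zero plateau_one (depth z.2, p (z.1, stretch (sndBlock z.2)))
      else if stretch (sndBlock z.2) ∈ Cube.boundary (Fin l) then
        shrink tent tent_zero tent_one (depth z.2, q (z.1, stretch (fstBlock z.2)))
      else ((c (z.1, (stretch (fstBlock z.2), stretch (sndBlock z.2)))).trans
        (q (z.1, stretch (fstBlock z.2))).symm).trans (p (z.1, stretch (sndBlock z.2))).symm, by
      refine continuous_collar hsu hsv hd
        ((shrink plateau plateau_zero plateau_one).continuous.comp (hd.prodMk hps))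
        ((shrink tent tent_zero tent_one).continuous.comp (hd.prodMk hqs))
        ?_ ?_ ?_ ?_ ?_
      · have h1 := Path.continuous_symm.comp hqs
        have h2 := Path.continuous_symm.comp hps
        exact Path.continuous_trans.comp ((Path.continuous_trans.comp (hcs.prodMk h1)).prodMk h2)
      · intro z hz
        exact stretch_boundary hz
      · intro z h1 h2
        rw [hpb _ _ h2, hqb _ _ h1, shrink_refl, shrink_refl]
      · intro z h1 h2
        rw [hqb _ _ h1, h2, hp1 _ _ h1, shrink_plateau_zero, Path.refl_symm]
      · intro z h1 h2
        rw [hpb _ _ h1, h2, hq1 _ _ h1, shrink_tent_zero, Path.refl_symm]⟩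
  have hK : ∀ z, K z = if stretch (fstBlock z.2) ∈ Cube.boundary (Fin k) then
        shrink plateau plateau_zero plateau_one (depth z.2, p (z.1, stretch (sndBlock z.2)))
      else if stretch (sndBlock z.2) ∈ Cube.boundary (Fin l) then
        shrink tent tent_zero tent_one (depth z.2, q (z.1, stretch (fstBlock z.2)))
      else ((c (z.1, (stretch (fstBlock z.2), stretch (sndBlock z.2)))).trans
        (q (z.1, stretch (fstBlock z.2))).symm).trans (p (z.1, stretch (sndBlock z.2))).symm :=
    fun _ => rfl
  -- At the two ends `c` comes from a map that is trivial on the boundary, so `p` and `q` are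
  -- constant there and the correction is mere padding.
  have hend : ∀ (t : I) (f : GenLoop (Fin (k + l)) (Path x x) (Path.refl x)),
      (∀ u v, c (t, (u, v)) = f (Fin.append u v)) → ∀ w, K (t, w) = stretchPad f w := by
    intro t f hf w
    have hp0 : ∀ v, p (t, v) = Path.refl x := fun v => hp2 t v fun u hu =>
      (hf u v).trans (f.2 _ (append_mem_boundary (Or.inl hu)))
    have hq0 : ∀ u, q (t, u) = Path.refl x := fun u => hq2 t u fun v hv =>
      (hf u v).trans (f.2 _ (append_mem_boundary (Or.inr hv)))
    have hst : (Fin.append (stretch (fstBlock w)) (stretch (sndBlock w)) : I^ Fin (k + l)) =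
      stretch w := append_blocks (stretch w)
    change _ = ((f (stretch w)).trans (Path.refl x)).trans (Path.refl x)
    rw [hK, ← hst, ← hf]
    dsimp only
    rw [hp0, hq0]
    split_ifs with h1 h2
    · rw [hp1 _ _ h1, hp0, shrink_refl, Path.refl_trans_refl, Path.refl_trans_refl]
    · rw [hq1 _ _ h2, hq0, shrink_refl, Path.refl_trans_refl, Path.refl_trans_refl]
    · rw [Path.refl_symm]
  rw [← sphereClass_stretchPad h, ← sphereClass_stretchPad h']
  refine sphereClass_eq_of_homotopy K (hend 0 h hc0') (hend 1 h' hc1') ?_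
  intro t w hw
  rw [hK]
  have hdw := depth_boundary hw
  split_ifs with h1 h2
  · rw [hdw, shrink_one]
  · rw [hdw, shrink_one]
  · exact absurd (stretch_boundary (w := w) (by rw [hdw]; exact one_ne_zero)) (by tauto)

end CollapseInjective

/-! ### Induced maps and the Samelson product of pointwise products -/

section Induced

variable {X Y : Type*} [TopologicalSpace X] [TopologicalSpace Y] {x : X} {y : Y} {k l n : ℕ}

/-- Postcomposition of generalized loops with a based map. -/
def genLoopMap (f : C(X, Y)) (hf : f x = y) (a : GenLoop (Fin n) X x) : GenLoop (Fin n) Y y :=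
  ⟨f.comp a.1, fun z hz => by rw [ContinuousMap.comp_apply, a.2 z hz, hf]⟩

lemma inducedMap_mk (f : C(X, Y)) (hf : f x = y) (a : GenLoop (Fin n) X x) :
    inducedMap f hf n ⟦a⟧ = ⟦genLoopMap f hf a⟧ := rfl

lemma inducedMap_mul (f : C(X, Y)) (hf : f x = y) (a b : π_ (n + 1) X x) :
    inducedMap f hf (n + 1) (a * b) = inducedMap f hf (n + 1) a * inducedMap f hf (n + 1) b := by
  induction a using Quotient.inductionOn with | _ a => ?_
  induction b using Quotient.inductionOn with | _ b => ?_
  have h1 := HomotopyGroup.mul_spec (i := (0 : Fin (n + 1))) (p := a) (q := b)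
  have h2 := HomotopyGroup.mul_spec (i := (0 : Fin (n + 1))) (p := genLoopMap f hf a)
    (q := genLoopMap f hf b)
  refine (congrArg (inducedMap f hf (n + 1)) h1).trans (Eq.trans ?_ h2.symm)
  rw [inducedMap_mk]
  refine congrArg _ (GenLoop.ext _ _ fun w => ?_)
  change f (GenLoop.transAt 0 b a w) = _
  unfold GenLoop.transAt
  simp only [GenLoop.coe_copy]
  split_ifs <;> rfl

lemma inducedMap_one (f : C(X, Y)) (hf : f x = y) :
    inducedMap f hf (n + 1) (1 : π_ (n + 1) X x) = 1 := by
  have h := inducedMap_mul f hf (1 : π_ (n + 1) X x) 1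
  rw [mul_one] at h
  exact (mul_eq_left (a := inducedMap f hf (n + 1) (1 : π_ (n + 1) X x))).1 h.symm

lemma inducedMap_comp {Z : Type*} [TopologicalSpace Z] {z : Z} (f : C(X, Y)) (hf : f x = y)
    (g : C(Y, Z)) (hg : g y = z) (hgf : (g.comp f) x = z) (a : π_ n X x) :
    inducedMap g hg n (inducedMap f hf n a) = inducedMap (g.comp f) hgf n a := by
  induction a using Quotient.inductionOn with | _ a => rfl

lemma inducedMap_eq_of_homotopicRel {f g : C(X, Y)} (hf : f x = y) (hg : g x = y)
    (h : f.HomotopicRel g {x}) (a : π_ n X x) : inducedMap f hf n a = inducedMap g hg n a := by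
  induction a using Quotient.inductionOn with | _ a => ?_
  obtain ⟨H⟩ := h
  refine Quotient.sound ⟨⟨⟨H.toContinuousMap.comp
    ⟨fun z : I × (I^ Fin n) => (z.1, a z.2), by
      have := a.1.continuous
      exact continuous_fst.prodMk (this.comp continuous_snd)⟩, ?_, ?_⟩, ?_⟩⟩
  · intro w
    exact H.apply_zero _
  · intro w
    exact H.apply_one _
  · intro t w hw
    exact H.eq_fst t (a.2 w hw)

/-- The class of an element of `π_n(ΩX)` in the fundamental group of `Ω^n X`. -/
def piClass (n : ℕ) (x : X) : π_ n (Path x x) (Path.refl x) →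
    MapGroup (sphereRel n) (Cube.boundary (Fin n)) x :=
  Quotient.lift sphereClass fun _ _ h => sphereClass_eq_iff.2 (Quotient.sound h)

lemma piClass_injective : Function.Injective (piClass n x) := by
  intro a b h
  induction a using Quotient.inductionOn with | _ a => ?_
  induction b using Quotient.inductionOn with | _ b => ?_
  exact sphereClass_eq_iff.1 h

lemma piClass_surjective : Function.Surjective (piClass n x) := fun a => by
  obtain ⟨f, rfl⟩ := sphereClass_surjective a
  exact ⟨⟦f⟧, rfl⟩

lemma sphereClass_const : sphereClass (GenLoop.const : GenLoop (Fin n) (Path x x) (Path.refl x)) =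
    1 := rfl

lemma piClass_inducedMap (f : C(X, Y)) (hf : f x = y) (a : π_ n (Path x x) (Path.refl x)) :
    piClass n y (inducedMap (loopMap f hf) (loopMap_refl f hf) n a) =
      mapGroupPush f hf (piClass n x a) := by
  induction a using Quotient.inductionOn with | _ a => ?_
  exact (mapGroupPush_mapClass f hf (sphereMapSet a)).symm

/-- The pointwise concatenation of generalized loops in a loop space. -/
def loopTrans (f g : GenLoop (Fin n) (Path x x) (Path.refl x)) :
    GenLoop (Fin n) (Path x x) (Path.refl x) :=
  ⟨⟨fun w => (f w).trans (g w), Path.continuous_trans.comp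
    (f.1.continuous.prodMk g.1.continuous)⟩, fun w hw => by
    change (f w).trans (g w) = _
    rw [GenLoop.boundary f w hw, GenLoop.boundary g w hw, Path.refl_trans_refl]⟩

lemma sphereClass_loopTrans (f g : GenLoop (Fin n) (Path x x) (Path.refl x)) :
    sphereClass (loopTrans f g) = sphereClass g * sphereClass f :=
  mapClass_trans (sphereMapSet f) (sphereMapSet g)

lemma commute_of_samelson {f : GenLoop (Fin k) (Path x x) (Path.refl x)}
    {g : GenLoop (Fin l) (Path x x) (Path.refl x)} (h : sphereClass (samelsonLoop f g) = 1) :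
    Commute (pullFst k l x (sphereClass f)) (pullSnd k l x (sphereClass g)) := by
  have h1 := collapse_samelsonLoop f g
  rw [h, map_one, ← mul_inv_rev, eq_comm, inv_mul_eq_one] at h1
  exact h1

/-- This direction needs the injectivity of the collapse; `commute_of_samelson` does not. -/
lemma samelson_of_commute {f : GenLoop (Fin k) (Path x x) (Path.refl x)}
    {g : GenLoop (Fin l) (Path x x) (Path.refl x)}
    (h : Commute (pullFst k l x (sphereClass f)) (pullSnd k l x (sphereClass g))) :
    sphereClass (samelsonLoop f g) = 1 := by
  refine collapse_injective k l x ?_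
  rw [collapse_samelsonLoop, map_one, ← mul_inv_rev, inv_mul_eq_one]
  exact h

/-- Commuting is symmetric, so the product taken in the other order on S^l × S^k serves equally well
after the swap. -/
lemma commute_of_samelson_swap {f : GenLoop (Fin k) (Path x x) (Path.refl x)}
    {g : GenLoop (Fin l) (Path x x) (Path.refl x)} (h : sphereClass (samelsonLoop g f) = 1) :
    Commute (pullFst k l x (sphereClass f)) (pullSnd k l x (sphereClass g)) := by
  have h1 := (commute_of_samelson h).map (pullSwap l k x)
  rw [pullSwap_pullFst, pullSwap_pullSnd] at h1
  exact h1.symm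

/-- Restriction to the diagonal of S^k × S^k turns the two projections into the identity. This also
covers k = 0, where the group is essentially π_1(X) and need not be abelian. -/
lemma commute_of_samelson_diag {f g : GenLoop (Fin k) (Path x x) (Path.refl x)}
    (h : sphereClass (samelsonLoop f g) = 1) : Commute (sphereClass f) (sphereClass g) := by
  have h1 := (commute_of_samelson h).map (pullDiag k x)
  rwa [pullDiag_pullFst, pullDiag_pullSnd] at h1

/-- The mixed pairs can be moved past each other, which separates the primed letters from the
unprimed ones. The hypotheses do not ask that `a` commute with `b`, nor `a'` with `b'`: those two
commutators survive. -/
lemma commutator_mul_of_commute {G : Type*} [Group G] {a b a' b' : G} (h1 : Commute a b')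
    (h2 : Commute a' b) (h3 : Commute a a') (h4 : Commute b b') :
    (b' * b)⁻¹ * (a' * a)⁻¹ * (b' * b * (a' * a)) =
      b'⁻¹ * a'⁻¹ * (b' * a') * (b⁻¹ * a⁻¹ * (b * a)) := by
  have e1 : b' * b * (a' * a) = (b' * a') * (b * a) := by
    rw [mul_assoc, ← mul_assoc b, h2.symm.eq, mul_assoc a', ← mul_assoc b']
  have e2 : (b' * b)⁻¹ * (a' * a)⁻¹ = (b⁻¹ * a⁻¹) * (b'⁻¹ * a'⁻¹) := by
    rw [← mul_inv_rev, ← mul_inv_rev a b, ← mul_inv_rev a' b', ← mul_inv_rev]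
    congr 1
    rw [mul_assoc, ← mul_assoc a, h1.eq, mul_assoc b', ← mul_assoc a']
  have hb : Commute (b⁻¹ * a⁻¹) (b'⁻¹ * a'⁻¹ * (b' * a')) := by
    have k1 : Commute (b⁻¹ * a⁻¹) b' := (h4.inv_left).mul_left h1.inv_left
    have k2 : Commute (b⁻¹ * a⁻¹) a' := (h2.symm.inv_left).mul_left h3.inv_left
    exact (k1.inv_right.mul_right k2.inv_right).mul_right (k1.mul_right k2)
  rw [e1, e2, ← mul_assoc, mul_assoc (b⁻¹ * a⁻¹), hb.eq, mul_assoc, ← mul_assoc (b⁻¹ * a⁻¹)]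

/-- After the collapse this is the group identity `commutator_mul_of_commute`. The vanishing of ⟨f,
f'⟩ and ⟨g, g'⟩ enters through the diagonal, in bidegrees (k, k) and (l, l). -/
lemma sphereClass_samelsonLoop_loopTrans {f f' : GenLoop (Fin k) (Path x x) (Path.refl x)}
    {g g' : GenLoop (Fin l) (Path x x) (Path.refl x)} (h1 : sphereClass (samelsonLoop f g') = 1)
    (h2 : sphereClass (samelsonLoop g f') = 1) (h3 : sphereClass (samelsonLoop f f') = 1)
    (h4 : sphereClass (samelsonLoop g g') = 1) :
    sphereClass (samelsonLoop (loopTrans f f') (loopTrans g g')) =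
      sphereClass (loopTrans (samelsonLoop f g) (samelsonLoop f' g')) := by
  refine collapse_injective k l x ?_
  rw [collapse_samelsonLoop, sphereClass_loopTrans, sphereClass_loopTrans, sphereClass_loopTrans,
    map_mul, map_mul, map_mul, collapse_samelsonLoop, collapse_samelsonLoop]
  exact commutator_mul_of_commute (commute_of_samelson h1) (commute_of_samelson_swap h2)
    ((commute_of_samelson_diag h3).map _) ((commute_of_samelson_diag h4).map _)

lemma loopMap_trans (f : C(X, Y)) (hf : f x = y) (γ δ : Path x x) :
    loopMap f hf (γ.trans δ) = (loopMap f hf γ).trans (loopMap f hf δ) := by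
  ext τ
  change f (γ.trans δ τ) = _
  rw [Path.trans_apply, Path.trans_apply]
  split_ifs <;> rfl

lemma loopMap_commutator (f : C(X, Y)) (hf : f x = y) (γ δ : Path x x) :
    loopMap f hf (commutator γ δ) = commutator (loopMap f hf γ) (loopMap f hf δ) := by
  change loopMap f hf ((γ.trans δ).trans (γ.symm.trans δ.symm)) = _
  rw [loopMap_trans, loopMap_trans, loopMap_trans]
  rfl

/-- An equality of representatives, since a looped map respects concatenation, reversal and the
reparametrizations by which the null-homotopies are defined. -/
lemma genLoopMap_samelsonLoop (f : C(X, Y)) (hf : f x = y)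
    (a : GenLoop (Fin k) (Path x x) (Path.refl x)) (b : GenLoop (Fin l) (Path x x) (Path.refl x)) :
    genLoopMap (loopMap f hf) (loopMap_refl f hf) (samelsonLoop a b) =
      samelsonLoop (genLoopMap (loopMap f hf) (loopMap_refl f hf) a)
        (genLoopMap (loopMap f hf) (loopMap_refl f hf) b) := by
  refine GenLoop.ext _ _ fun w => ?_
  change loopMap f hf (samelsonMap a b w) = samelsonMap _ _ w
  unfold samelsonMap
  split_ifs
  · rfl
  · rfl
  · exact loopMap_commutator f hf _ _

end Induced

/-! ### Currying: the Whitehead and the Samelson product -/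

section Curry

variable {X Y : Type*} [TopologicalSpace X] [TopologicalSpace Y] {x : X} {y : Y} {k l n : ℕ}

/-- The generalized loop in `ΩX` with `f̂(u)(τ) = f(τ, u)`. -/
def curryLoop (f : GenLoop (Fin (n + 1)) X x) : GenLoop (Fin n) (Path x x) (Path.refl x) :=
  ⟨⟨fun u =>
    { toFun := fun τ => f (Fin.cons τ u)
      continuous_toFun := f.1.continuous.comp (by fun_prop)
      source' := f.2 _ ⟨0, by simp⟩
      target' := f.2 _ ⟨0, by simp⟩ }, by
      refine Path.continuous_uncurry_iff.mp ?_
      change Continuous fun z : (I^ Fin n) × I => f (Fin.cons z.2 z.1)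
      exact f.1.continuous.comp (by fun_prop)⟩,
    fun u hu => by
      ext τ
      exact f.2 _ (cons_mem_boundary (Or.inr hu))⟩

/-- The inverse of `curryLoop`. -/
def uncurryLoop (g : GenLoop (Fin n) (Path x x) (Path.refl x)) : GenLoop (Fin (n + 1)) X x :=
  ⟨⟨fun w => g (Fin.tail w) (w 0), by
    have h1 : Continuous fun w : I^ Fin (n + 1) => g (Fin.tail w) :=
      g.1.continuous.comp (by unfold Fin.tail; fun_prop)
    fun_prop⟩, fun w hw => by
    obtain ⟨i, hi⟩ := hw
    change g (Fin.tail w) (w 0) = x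
    revert hi
    refine Fin.cases (fun hi => ?_) (fun j hj => ?_) i
    · rcases hi with hi | hi <;> simp [hi]
    · rw [GenLoop.boundary g (Fin.tail w) ⟨j, hj⟩]; rfl⟩

lemma curryLoop_uncurryLoop (g : GenLoop (Fin n) (Path x x) (Path.refl x)) :
    curryLoop (uncurryLoop g) = g := by
  refine GenLoop.ext _ _ fun u => ?_
  ext τ
  rfl

lemma uncurryLoop_curryLoop (f : GenLoop (Fin (n + 1)) X x) :
    uncurryLoop (curryLoop f) = f :=
  GenLoop.ext _ _ fun w => congrArg f (Fin.cons_self_tail w)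

lemma curryLoop_homotopic {f g : GenLoop (Fin (n + 1)) X x} (h : GenLoop.Homotopic f g) :
    GenLoop.Homotopic (curryLoop f) (curryLoop g) := by
  obtain ⟨H⟩ := h
  have hb : ∀ t, ∀ w ∈ Cube.boundary (Fin (n + 1)), H (t, w) = x := fun t w hw =>
    (H.eq_fst t hw).trans (f.2 w hw)
  refine ⟨⟨⟨⟨fun z =>
    { toFun := fun τ => H (z.1, Fin.cons τ z.2)
      continuous_toFun := H.continuous.comp (by fun_prop)
      source' := hb _ _ ⟨0, by simp⟩
      target' := hb _ _ ⟨0, by simp⟩ }, ?_⟩, ?_, ?_⟩, ?_⟩⟩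
  · refine Path.continuous_uncurry_iff.mp ?_
    change Continuous fun q : (I × (I^ Fin n)) × I => H (q.1.1, Fin.cons q.2 q.1.2)
    exact H.continuous.comp (by fun_prop)
  · intro u
    ext τ
    exact H.apply_zero _
  · intro u
    ext τ
    exact H.apply_one _
  · intro t u hu
    ext τ
    exact H.eq_fst t (cons_mem_boundary (Or.inr hu))

lemma uncurryLoop_homotopic {f g : GenLoop (Fin n) (Path x x) (Path.refl x)}
    (h : GenLoop.Homotopic f g) : GenLoop.Homotopic (uncurryLoop f) (uncurryLoop g) := by
  obtain ⟨H⟩ := h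
  have hb : ∀ t, ∀ w ∈ Cube.boundary (Fin n), H (t, w) = Path.refl x := fun t w hw =>
    (H.eq_fst t hw).trans (f.2 w hw)
  refine ⟨⟨⟨⟨fun z => H (z.1, Fin.tail z.2) (z.2 0), ?_⟩, ?_, ?_⟩, ?_⟩⟩
  · have h1 : Continuous fun z : I × (I^ Fin (n + 1)) => H (z.1, Fin.tail z.2) :=
      H.continuous.comp (by unfold Fin.tail; fun_prop)
    fun_prop
  · intro w
    change H (0, Fin.tail w) (w 0) = _
    rw [H.apply_zero]; rfl
  · intro w
    change H (1, Fin.tail w) (w 0) = _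
    rw [H.apply_one]; rfl
  · intro t w hw
    refine Eq.trans ?_ ((uncurryLoop f).2 w hw).symm
    change H (t, Fin.tail w) (w 0) = x
    obtain ⟨i, hi⟩ := hw
    revert hi
    refine Fin.cases (fun hi => ?_) (fun j hj => ?_) i
    · rcases hi with hi | hi <;> simp [hi]
    · rw [hb t (Fin.tail w) ⟨j, hj⟩]; rfl

/-- The bijection `π_(n+1)(X) → π_n(ΩX)`. -/
def curryPi (n : ℕ) (x : X) : π_ (n + 1) X x → π_ n (Path x x) (Path.refl x) :=
  Quotient.map curryLoop fun _ _ => curryLoop_homotopic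

lemma curryPi_mk (f : GenLoop (Fin (n + 1)) X x) : curryPi n x ⟦f⟧ = ⟦curryLoop f⟧ := rfl

lemma curryPi_injective : Function.Injective (curryPi n x) := by
  intro a b h
  induction a using Quotient.inductionOn with | _ a => ?_
  induction b using Quotient.inductionOn with | _ b => ?_
  have h1 := uncurryLoop_homotopic (Quotient.exact h)
  rw [uncurryLoop_curryLoop, uncurryLoop_curryLoop] at h1
  exact Quotient.sound h1

lemma curryPi_surjective : Function.Surjective (curryPi n x) := fun a => by
  induction a using Quotient.inductionOn with | _ a => ?_
  exact ⟨⟦uncurryLoop a⟧, (curryPi_mk _).trans (by rw [curryLoop_uncurryLoop])⟩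

lemma curryPi_one : curryPi n x 1 = ⟦GenLoop.const⟧ := rfl

lemma curryPi_inducedMap (f : C(X, Y)) (hf : f x = y) (a : π_ (n + 1) X x) :
    curryPi n y (inducedMap f hf (n + 1) a) =
      inducedMap (loopMap f hf) (loopMap_refl f hf) n (curryPi n x a) := by
  induction a using Quotient.inductionOn with | _ a => rfl

/-- Each quarter of the commutator loop traverses one factor while the path around the square runs
along one side, on which the other coordinate is 0 or 1. -/
lemma commutator_apply_cases (γ δ : Path x x) (τ : I) :
    (squareSnd τ = 0 ∨ squareSnd τ = 1) ∧ commutator γ δ τ = γ (squareFst τ) ∨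
      (squareFst τ = 0 ∨ squareFst τ = 1) ∧ commutator γ δ τ = δ (squareSnd τ) := by
  have hc : commutator γ δ τ = ((γ.trans δ).trans (γ.symm.trans δ.symm)) τ := rfl
  rw [hc]
  simp only [Path.trans_apply, Path.symm_apply]
  have h0 := τ.2.1
  have h1 := τ.2.2
  split_ifs with h2 h3 h3
  · refine Or.inl ⟨Or.inl (Set.projIcc_of_le_left _ (min_le_of_left_le (by linarith))),
      (path_projIcc_eq γ ?_).symm⟩
    rw [min_eq_left (by linarith : 4 * (τ : ℝ) ≤ 3 - 4 * τ), min_eq_right (by linarith),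
      max_eq_right (by linarith)]
    ring
  · refine Or.inr ⟨Or.inr (Set.projIcc_of_right_le _ (le_min (by linarith) (by linarith))),
      (path_projIcc_eq δ ?_).symm⟩
    rw [min_eq_left (by linarith : 4 * (τ : ℝ) - 1 ≤ 4 - 4 * τ), min_eq_right (by linarith),
      max_eq_right (by linarith)]
    ring
  · refine Or.inl ⟨Or.inr (Set.projIcc_of_right_le _ (le_min (by linarith) (by linarith))),
      (path_projIcc_eq γ ?_).symm⟩
    change _ = 1 - (2 * (2 * (τ : ℝ) - 1))
    rw [min_eq_right (by linarith : 3 - 4 * τ ≤ 4 * (τ : ℝ)), min_eq_right (by linarith),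
      max_eq_right (by linarith)]
    ring
  · refine Or.inr ⟨Or.inl (Set.projIcc_of_le_left _ (min_le_of_right_le (by linarith))),
      (path_projIcc_eq δ ?_).symm⟩
    change _ = 1 - (2 * (2 * (τ : ℝ) - 1) - 1)
    rw [min_eq_right (by linarith : 4 - 4 * τ ≤ 4 * (τ : ℝ) - 1), min_eq_right (by linarith),
      max_eq_right (by linarith)]
    ring

lemma path_apply_of_eq (γ : Path x x) {t : I} (h : t = 0 ∨ t = 1) : γ t = x := by
  rcases h with rfl | rfl
  · exact γ.source
  · exact γ.target

lemma commutator_apply_fst (γ δ : Path x x) {τ : I} (h : squareSnd τ = 0 ∨ squareSnd τ = 1) :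
    commutator γ δ τ = γ (squareFst τ) := by
  rcases commutator_apply_cases γ δ τ with h1 | h1
  · exact h1.2
  · rw [h1.2, path_apply_of_eq δ h, path_apply_of_eq γ h1.1]

lemma commutator_apply_snd (γ δ : Path x x) {τ : I} (h : squareFst τ = 0 ∨ squareFst τ = 1) :
    commutator γ δ τ = δ (squareSnd τ) := by
  rcases commutator_apply_cases γ δ τ with h1 | h1
  · rw [h1.2, path_apply_of_eq γ h, path_apply_of_eq δ h1.1]
  · exact h1.2

lemma unionMap_of_left {X : Type*} {x : X} {m n : ℕ} {f : (I^ Fin m) → X} {g : (I^ Fin n) → X}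
    (hf : ∀ a ∈ Cube.boundary (Fin m), f a = x) (hg : ∀ b ∈ Cube.boundary (Fin n), g b = x)
    {z : (I^ Fin m) × (I^ Fin n)} (hz : z.1 ∈ Cube.boundary (Fin m)) :
    unionMap f g z = g z.2 := by
  unfold unionMap
  split_ifs with h
  · rw [hf _ hz, hg _ h]
  · rfl

lemma unionMap_of_right {X : Type*} {m n : ℕ} {f : (I^ Fin m) → X} {g : (I^ Fin n) → X}
    {z : (I^ Fin m) × (I^ Fin n)} (hz : z.2 ∈ Cube.boundary (Fin n)) :
    unionMap f g z = f z.1 := by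
  unfold unionMap
  exact if_pos hz

/-- For a fixed inner point `w`, the curve τ ↦ `sphereMap` goes around the square, and f ∪ g along
it is the commutator of the two adjoint loops. In the collar the square shrinks by the factor `σ
(depth w)`, which is exactly the null-homotopy built from `shrink`. -/
lemma curryLoop_whiteheadLoop (f : GenLoop (Fin (k + 1)) X x) (g : GenLoop (Fin (l + 1)) X x) :
    curryLoop (whiteheadLoop f g) = samelsonLoop (curryLoop f) (curryLoop g) := by
  refine GenLoop.ext _ _ fun w => ?_
  ext τ
  change unionMap f.1 g.1 (sphereMap k l (Fin.cons τ w)) =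
    samelsonMap (curryLoop f) (curryLoop g) w τ
  unfold samelsonMap
  have hS : sphereMap k l (Fin.cons τ w) =
      (Fin.cons (σ (depth w) * squareFst τ) (stretch (fstBlock w)),
        Fin.cons (σ (depth w) * squareSnd τ) (stretch (sndBlock w))) := by
    simp [sphereMap]
  rw [hS]
  split_ifs with h1 h2
  · rw [unionMap_of_left f.2 g.2 (cons_mem_boundary (Or.inr h1))]
    rfl
  · rw [unionMap_of_right (cons_mem_boundary (Or.inr h2))]
    rfl
  · have hd : depth w = 0 := by
      by_contra hd
      exact (stretch_boundary hd).elim h1 h2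
    rw [hd, unitInterval.symm_zero, one_mul, one_mul]
    rcases square_boundary τ with h | h
    · rw [unionMap_of_left f.2 g.2 (cons_mem_boundary (Or.inl h)), commutator_apply_snd _ _ h]
      rfl
    · rw [unionMap_of_right (cons_mem_boundary (Or.inl h)), commutator_apply_fst _ _ h]
      rfl

lemma curryPi_whitehead (a : π_ (k + 1) X x) (b : π_ (l + 1) X x) :
    curryPi (k + l) x (whitehead a b) = samelson (curryPi k x a) (curryPi l x b) := by
  induction a using Quotient.inductionOn with | _ a => ?_
  induction b using Quotient.inductionOn with | _ b => ?_
  exact congrArg (Quotient.mk _) (curryLoop_whiteheadLoop a b)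

lemma inducedMap_whitehead (f : C(X, Y)) (hf : f x = y) (a : π_ (k + 1) X x)
    (b : π_ (l + 1) X x) : inducedMap f hf (k + l + 1) (whitehead a b) =
      whitehead (inducedMap f hf (k + 1) a) (inducedMap f hf (l + 1) b) := by
  induction a using Quotient.inductionOn with | _ a => ?_
  induction b using Quotient.inductionOn with | _ b => ?_
  refine congrArg (Quotient.mk _) (GenLoop.ext _ _ fun w => ?_)
  change f (unionMap a.1 b.1 _) = unionMap (f.comp a.1) (f.comp b.1) _
  unfold unionMap
  split_ifs <;> rfl

/-- On the loop space side, the pullback of a constant class is 1, which commutes with everything.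
-/
lemma whitehead_one (a : π_ (k + 1) X x) : whitehead a (1 : π_ (l + 1) X x) = 1 := by
  refine curryPi_injective (piClass_injective ?_)
  rw [curryPi_whitehead, curryPi_one]
  generalize curryPi k x a = a
  induction a using Quotient.inductionOn with | _ a => ?_
  refine (samelson_of_commute (f := a) (g := GenLoop.const) ?_).trans ?_
  · rw [sphereClass_const, map_one]
    exact Commute.one_right _
  · rfl

end Curry

/-! ### Relative lifting on cubes -/

section Lifting

variable {m : ℕ}

/-- The reciprocal of the dilation factor that moves `(t, y)` along the ray from `(2, 1/2, …, 1/2)`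
to the faces `t = 0` or `y ∈ ∂I^m`. -/
def coneGauge (w : I^ Fin (m + 1)) : ℝ :=
  max ((2 - (w 0 : ℝ)) / 2) (2 * ‖fun i : Fin m => (w i.succ : ℝ) - 1 / 2‖)

lemma continuous_coneGauge : Continuous (coneGauge (m := m)) := by
  unfold coneGauge
  fun_prop

/-- The apex at height 2 lies outside the cube; it gives this lower bound, which keeps the travel
time `(coneGauge w)⁻¹ - 1` inside `I`. -/
lemma coneGauge_ge (w : I^ Fin (m + 1)) : 1 / 2 ≤ coneGauge w :=
  le_max_of_le_left (by linarith [(w 0).2.2])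

lemma coneGauge_pos (w : I^ Fin (m + 1)) : 0 < coneGauge w :=
  lt_of_lt_of_le (by norm_num) (coneGauge_ge w)

lemma abs_sub_half_le (t : I) : |(t : ℝ) - 1 / 2| ≤ 1 / 2 :=
  abs_le.2 ⟨by linarith [t.2.1], by linarith [t.2.2]⟩

lemma coneGauge_le (w : I^ Fin (m + 1)) : coneGauge w ≤ 1 := by
  refine max_le (by linarith [(w 0).2.1]) ?_
  have : ‖fun i : Fin m => (w i.succ : ℝ) - 1 / 2‖ ≤ 1 / 2 :=
    (pi_norm_le_iff_of_nonneg (by norm_num)).2 fun i => abs_sub_half_le _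
  linarith

lemma coneGauge_eq_one {w : I^ Fin (m + 1)}
    (hw : w 0 = 0 ∨ (Fin.tail w : I^ Fin m) ∈ Cube.boundary (Fin m)) : coneGauge w = 1 := by
  refine le_antisymm (coneGauge_le w) ?_
  rcases hw with hw | ⟨i, hi⟩
  · refine le_max_of_le_left ?_
    rw [hw]; norm_num
  · refine le_max_of_le_right ?_
    have h1 := norm_le_pi_norm (fun i : Fin m => (w i.succ : ℝ) - 1 / 2) i
    have h2 : ‖(w i.succ : ℝ) - 1 / 2‖ = 1 / 2 := by
      change w i.succ = 0 ∨ w i.succ = 1 at hi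
      rcases hi with hi | hi <;> rw [hi] <;> norm_num
    linarith

/-- The time after which the flow `coneFlow` reaches `w`. -/
def coneTime (w : I^ Fin (m + 1)) : I :=
  ⟨(coneGauge w)⁻¹ - 1, by
    have := one_le_inv₀ (coneGauge_pos w) |>.2 (coneGauge_le w)
    linarith, by
    have := inv_anti₀ (by norm_num) (coneGauge_ge w)
    norm_num at this ⊢
    linarith⟩

/-- The flow that starts on the faces `t = 0` and `y ∈ ∂I^m` and runs along the ray towards
`(2, 1/2, …, 1/2)` until it reaches `w`. -/
def coneFlow (w : I^ Fin (m + 1)) (r : I) : I^ Fin (m + 1) :=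
  Fin.cons (Set.projIcc 0 1 zero_le_one (2 + max ((coneGauge w)⁻¹ - r) 1 * ((w 0 : ℝ) - 2)))
    fun i => Set.projIcc 0 1 zero_le_one
      (1 / 2 + max ((coneGauge w)⁻¹ - r) 1 * ((w i.succ : ℝ) - 1 / 2))

lemma continuous_coneGauge_inv : Continuous fun w : I^ Fin (m + 1) => (coneGauge w)⁻¹ :=
  continuous_coneGauge.inv₀ fun w => (coneGauge_pos w).ne'

lemma continuous_coneTime : Continuous (coneTime (m := m)) :=
  Continuous.subtype_mk (continuous_coneGauge_inv.sub continuous_const) _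

lemma continuous_coneFlow :
    Continuous fun z : (I^ Fin (m + 1)) × I => coneFlow z.1 z.2 := by
  have h : Continuous fun z : (I^ Fin (m + 1)) × I => (coneGauge z.1)⁻¹ :=
    continuous_coneGauge_inv.comp continuous_fst
  refine continuous_pi fun i => ?_
  unfold coneFlow
  refine Fin.cases ?_ (fun j => ?_) i
  · simp only [Fin.cons_zero]
    exact continuous_projIcc.comp (by fun_prop)
  · simp only [Fin.cons_succ]
    exact continuous_projIcc.comp (by fun_prop)

lemma coneFlow_coneTime (w : I^ Fin (m + 1)) : coneFlow w (coneTime w) = w := by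
  have h : max ((coneGauge w)⁻¹ - (coneTime w : ℝ)) 1 = 1 := by
    simp [coneTime]
  unfold coneFlow
  rw [h]
  funext i
  refine Fin.cases ?_ (fun j => ?_) i
  · simp
  · simp

/-- At time 0 the dilation factor is the inverse of the gauge, so the term that attains the maximum
in `coneGauge` tells which face is hit: the bottom, or a side in the direction of a largest
coordinate. -/
lemma coneFlow_zero_mem (w : I^ Fin (m + 1)) :
    coneFlow w 0 0 = 0 ∨ (Fin.tail (coneFlow w 0) : I^ Fin m) ∈ Cube.boundary (Fin m) := by
  have hpos := coneGauge_pos w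
  have h : max ((coneGauge w)⁻¹ - ((0 : I) : ℝ)) 1 = (coneGauge w)⁻¹ := by
    rw [Set.Icc.coe_zero, sub_zero]
    exact max_eq_left ((one_le_inv₀ hpos).2 (coneGauge_le w))
  unfold coneFlow
  rw [h]
  rcases max_choice ((2 - (w 0 : ℝ)) / 2) (2 * ‖fun i : Fin m => (w i.succ : ℝ) - 1 / 2‖)
    with hc | hc
  · left
    refine Set.projIcc_of_le_left zero_le_one (le_of_eq ?_)
    have hg : coneGauge w = (2 - (w 0 : ℝ)) / 2 := hc
    have : (w 0 : ℝ) - 2 = -(2 * coneGauge w) := by rw [hg]; ring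
    rw [this]
    field_simp
    ring
  · right
    have hg : coneGauge w = 2 * ‖fun i : Fin m => (w i.succ : ℝ) - 1 / 2‖ := hc
    -- For m = 0 there are no side faces; the norm would be 0 and the gauge would not be positive.
    have hm : Nonempty (Fin m) := by
      by_contra hm
      rw [not_nonempty_iff] at hm
      have : ‖fun i : Fin m => (w i.succ : ℝ) - 1 / 2‖ = 0 := by
        rw [norm_eq_zero]; exact Subsingleton.elim _ _
      linarith
    obtain ⟨i, hi⟩ := Finite.exists_max fun i : Fin m => ‖(w i.succ : ℝ) - 1 / 2‖
    have hi' : ‖fun i : Fin m => (w i.succ : ℝ) - 1 / 2‖ = ‖(w i.succ : ℝ) - 1 / 2‖ :=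
      le_antisymm ((pi_norm_le_iff_of_nonneg (norm_nonneg _)).2 hi)
        (norm_le_pi_norm (fun i : Fin m => (w i.succ : ℝ) - 1 / 2) i)
    rw [hi', Real.norm_eq_abs] at hg
    refine ⟨i, ?_⟩
    change Set.projIcc (0 : ℝ) 1 zero_le_one _ = 0 ∨ Set.projIcc (0 : ℝ) 1 zero_le_one _ = 1
    rcases abs_choice ((w i.succ : ℝ) - 1 / 2) with ha | ha
    · right
      refine Set.projIcc_of_right_le _ (ge_of_eq ?_)
      have : (w i.succ : ℝ) - 1 / 2 = coneGauge w / 2 := by rw [hg, ha]; ring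
      rw [this]
      field_simp
      norm_num
    · left
      refine Set.projIcc_of_le_left _ (le_of_eq ?_)
      have : (w i.succ : ℝ) - 1 / 2 = -(coneGauge w / 2) := by rw [hg, ha]; ring
      rw [this]
      field_simp
      norm_num

lemma exists_coneFlow (m : ℕ) :
    ∃ (D : C((I^ Fin (m + 1)) × I, I^ Fin (m + 1))) (r : C(I^ Fin (m + 1), I)),
      (∀ w, D (w, r w) = w) ∧
      (∀ w, D (w, 0) 0 = 0 ∨ (Fin.tail (D (w, 0)) : I^ Fin m) ∈ Cube.boundary (Fin m)) ∧
      ∀ w, (w 0 = 0 ∨ (Fin.tail w : I^ Fin m) ∈ Cube.boundary (Fin m)) → r w = 0 :=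
  ⟨⟨_, continuous_coneFlow⟩, ⟨_, continuous_coneTime⟩, coneFlow_coneTime, coneFlow_zero_mem,
    fun _ hw => Subtype.ext (by simp [coneTime, coneGauge_eq_one hw])⟩

variable {E B : Type*} [TopologicalSpace E] [TopologicalSpace B] {p : C(E, B)}

/-- The lift is prescribed on the bottom and the sides of the cube of dimension m + 1. Each point
`w` is reached from there along its flow line, so lifting the flow lines, with all of I^(m+1) as
parameter space, and stopping at time `r w` lifts the homotopy. Since `r = 0` on the prescribed
faces, the lift has the prescribed values exactly. -/
lemma IsSerreFibration.exists_lift_rel (hp : IsSerreFibration p) (K : C(I^ Fin m, E))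
    {θ : C(I^ Fin m, B)} (h : (p.comp K).HomotopicRel θ (Cube.boundary (Fin m))) :
    ∃ K' : C(I^ Fin m, E), K.HomotopicRel K' (Cube.boundary (Fin m)) ∧ p.comp K' = θ := by
  obtain ⟨Θ⟩ := h
  obtain ⟨D, r, hD, hD0, hr⟩ := exists_coneFlow m
  have ht : Continuous (fun w : I^ Fin (m + 1) => (Fin.tail w : I^ Fin m)) := by
    unfold Fin.tail; fun_prop
  have hc : Continuous (fun z : I × (I^ Fin m) => (Fin.cons z.1 z.2 : I^ Fin (m + 1))) := by
    fun_prop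
  have h0 : Continuous fun w : I^ Fin (m + 1) => D (w, 0) := by fun_prop
  obtain ⟨G, hG0, hG⟩ := hp (m + 1)
    ⟨fun z => Θ (D z 0, Fin.tail (D z)), Θ.continuous.comp
      (((continuous_apply 0).comp D.continuous).prodMk (ht.comp D.continuous))⟩
    ⟨fun w => K (Fin.tail (D (w, 0))), K.continuous.comp (ht.comp h0)⟩ (by
      intro w
      change p (K (Fin.tail (D (w, 0)))) = Θ (D (w, 0) 0, Fin.tail (D (w, 0)))
      rcases hD0 w with hw | hw
      · rw [hw, Θ.apply_zero]; rfl
      · exact (Θ.eq_fst _ hw).symm)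
  have hbase : ∀ w : I^ Fin (m + 1),
      (w 0 = 0 ∨ (Fin.tail w : I^ Fin m) ∈ Cube.boundary (Fin m)) →
        G (w, r w) = K (Fin.tail w) := by
    intro w hw
    have h2 := hD w
    rw [hr w hw] at h2 ⊢
    rw [hG0]
    change K (Fin.tail (D (w, 0))) = _
    rw [h2]
  have hcov : ∀ w : I^ Fin (m + 1), p (G (w, r w)) = Θ (w 0, Fin.tail w) := by
    intro w
    rw [hG]
    change Θ (D (w, r w) 0, Fin.tail (D (w, r w))) = _
    rw [hD]
  have hL : Continuous fun z : I × (I^ Fin m) =>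
      G ((Fin.cons z.1 z.2 : I^ Fin (m + 1)), r (Fin.cons z.1 z.2 : I^ Fin (m + 1))) :=
    G.continuous.comp (hc.prodMk (r.continuous.comp hc))
  refine ⟨⟨fun y => G ((Fin.cons 1 y : I^ Fin (m + 1)), r (Fin.cons 1 y : I^ Fin (m + 1))),
    hL.comp (continuous_const.prodMk continuous_id)⟩, ⟨⟨⟨⟨_, hL⟩, ?_, ?_⟩, ?_⟩⟩, ?_⟩
  · intro y
    have := hbase (Fin.cons 0 y) (Or.inl (by simp))
    simpa using this
  · intro y
    rfl
  · intro t y hy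
    have := hbase (Fin.cons t y) (Or.inr (by simpa using hy))
    simpa using this
  · ext y
    have := hcov (Fin.cons 1 y)
    simp only [Fin.cons_zero, Fin.tail_cons] at this
    exact this.trans (Θ.apply_one y)

end Lifting

/-! ### The homotopy sequence of the fibration -/

section Exactness

variable {E B : Type*} [TopologicalSpace E] [TopologicalSpace B] {p : C(E, B)} {e₀ : E} {b₀ : B}
  (hp : p e₀ = b₀) {n : ℕ}

lemma fibreIncl_base : fibreIncl p b₀ ⟨e₀, hp⟩ = e₀ := rfl

/-- Lifting a null-homotopy of p ∘ a relative to the boundary deforms `a` into the fibre. -/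
lemma IsSerreFibration.mem_range_of_eq_one (hfib : IsSerreFibration p) (a : π_ (n + 1) E e₀)
    (ha : inducedMap p hp (n + 1) a = 1) :
    ∃ c : π_ (n + 1) (Fibre p b₀) ⟨e₀, hp⟩,
      inducedMap (y := e₀) (fibreIncl p b₀) (fibreIncl_base hp) (n + 1) c = a := by
  induction a using Quotient.inductionOn with | _ a => ?_
  have h : GenLoop.Homotopic (genLoopMap p hp a) GenLoop.const := Quotient.exact ha
  obtain ⟨K, ⟨H⟩, hK⟩ := hfib.exists_lift_rel a.1 h
  have hb : ∀ w ∈ Cube.boundary (Fin (n + 1)), K w = e₀ := fun w hw =>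
    (H.apply_one w).symm.trans ((H.eq_fst 1 hw).trans (a.2 w hw))
  let g : GenLoop (Fin (n + 1)) E e₀ := ⟨K, hb⟩
  refine ⟨⟦⟨⟨fun w => ⟨K w, ContinuousMap.congr_fun hK w⟩, by fun_prop⟩,
    fun w hw => Subtype.ext (hb w hw)⟩⟧, ?_⟩
  refine Eq.trans (b := (⟦g⟧ : π_ (n + 1) E e₀)) rfl (Quotient.sound ?_)
  exact ContinuousMap.HomotopicRel.symm ⟨H⟩

variable (s : C(B, E))

lemma inducedMap_section (hs : s b₀ = e₀)
    (hsec : (p.comp s).HomotopicRel (ContinuousMap.id B) {b₀}) (a : π_ n B b₀) :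
    inducedMap p hp n (inducedMap s hs n a) = a := by
  have hps : (p.comp s) b₀ = b₀ := by rw [ContinuousMap.comp_apply, hs, hp]
  refine (inducedMap_comp s hs p hp hps a).trans
    ((inducedMap_eq_of_homotopicRel hps rfl hsec a).trans ?_)
  induction a using Quotient.inductionOn with | _ a => rfl

/-- A null-homotopy `H` in `E` of a loop in the fibre projects to an element `P` of π_(n+2)(B), the
obstruction to pushing `H` into the fibre. As P = p_*(s_*P), appending the inverse of s_*P to `H`
kills the obstruction without changing the boundary values that matter. -/
lemma IsSerreFibration.eq_one_of_eq_one (hfib : IsSerreFibration p) (hs : s b₀ = e₀)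
    (hsec : (p.comp s).HomotopicRel (ContinuousMap.id B) {b₀})
    (c : π_ (n + 1) (Fibre p b₀) ⟨e₀, hp⟩)
    (hc : inducedMap (y := e₀) (fibreIncl p b₀) (fibreIncl_base hp) (n + 1) c = 1) : c = 1 := by
  induction c using Quotient.inductionOn with | _ b => ?_
  have h : GenLoop.Homotopic (genLoopMap (y := e₀) (fibreIncl p b₀) (fibreIncl_base hp) b)
      GenLoop.const :=
    Quotient.exact hc
  obtain ⟨H⟩ := h
  have hHb : ∀ t, ∀ y ∈ Cube.boundary (Fin (n + 1)), H (t, y) = e₀ := fun t y hy =>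
    (H.eq_fst t hy).trans ((genLoopMap (y := e₀) (fibreIncl p b₀) (fibreIncl_base hp) b).2 y hy)
  have hH0 : ∀ y, H (0, y) = (b y).1 := H.apply_zero
  have hH1 : ∀ y, H (1, y) = e₀ := H.apply_one
  have hpH : ∀ t y, (t = 0 ∨ t = 1) ∨ y ∈ Cube.boundary (Fin (n + 1)) → p (H (t, y)) = b₀ := by
    rintro t y ((rfl | rfl) | hy)
    · rw [hH0, (b y).2]
    · rw [hH1, hp]
    · rw [hHb t y hy, hp]
  let P : GenLoop (Fin (n + 2)) B b₀ := uncurryLoop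
    ⟨⟨fun y => ⟨⟨fun t => p (H (t, y)), by fun_prop⟩, hpH 0 y (Or.inl (Or.inl rfl)),
      hpH 1 y (Or.inl (Or.inr rfl))⟩, by
        refine Path.continuous_uncurry_iff.mp ?_
        change Continuous fun z : (I^ Fin (n + 1)) × I => p (H (z.2, z.1))
        fun_prop⟩, fun y hy => by
        ext t
        exact hpH t y (Or.inr hy)⟩
  have hP : ∀ w, P w = p (H (w 0, Fin.tail w)) := fun _ => rfl
  let Q : GenLoop (Fin (n + 2)) E e₀ := genLoopMap s hs P
  have hPQ : (⟦genLoopMap p hp Q⟧ : π_ (n + 2) B b₀) = ⟦P⟧ :=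
    inducedMap_section hp s hs hsec ⟦P⟧
  have ht : Continuous (fun w : I^ Fin (n + 2) => (Fin.tail w : I^ Fin (n + 1))) := by
    unfold Fin.tail; fun_prop
  have hu1 : Continuous fun w : I^ Fin (n + 2) => Set.projIcc (0 : ℝ) 1 zero_le_one (2 * w 0) :=
    continuous_projIcc.comp (by fun_prop)
  have hu2 : Continuous fun w : I^ Fin (n + 2) =>
      σ (Set.projIcc (0 : ℝ) 1 zero_le_one (2 * w 0 - 1)) :=
    unitInterval.continuous_symm.comp (continuous_projIcc.comp (by fun_prop))
  -- The first half runs `H`, the second half runs `Q` backwards; both are `e₀` on the common face.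
  let K : C(I^ Fin (n + 2), E) :=
    ⟨fun w => if (w 0 : ℝ) ≤ 1 / 2 then H (Set.projIcc 0 1 zero_le_one (2 * w 0), Fin.tail w)
      else Q (Fin.cons (σ (Set.projIcc (0 : ℝ) 1 zero_le_one (2 * w 0 - 1))) (Fin.tail w)), by
      refine continuous_if_le (by fun_prop) (by fun_prop)
        (H.continuous.comp (hu1.prodMk ht)).continuousOn
        (Q.1.continuous.comp (by fun_prop)).continuousOn ?_
      intro w hw
      have h1 : Set.projIcc (0 : ℝ) 1 zero_le_one (2 * w 0) = 1 :=
        Set.projIcc_of_right_le _ (by linarith)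
      have h2 : Set.projIcc (0 : ℝ) 1 zero_le_one (2 * w 0 - 1) = 0 :=
        Set.projIcc_of_le_left _ (by linarith)
      rw [h1, h2, hH1]
      exact (Q.2 _ ⟨0, by simp⟩).symm⟩
  have hK : ∀ w, K w = if (w 0 : ℝ) ≤ 1 / 2 then
      H (Set.projIcc 0 1 zero_le_one (2 * w 0), Fin.tail w)
      else Q (Fin.cons (σ (Set.projIcc (0 : ℝ) 1 zero_le_one (2 * w 0 - 1))) (Fin.tail w)) :=
    fun _ => rfl
  have hpK : p.comp K = (GenLoop.transAt 0 P (GenLoop.symmAt 0 (genLoopMap p hp Q))).1 := by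
    ext w
    change p (K w) = GenLoop.transAt 0 P (GenLoop.symmAt 0 (genLoopMap p hp Q)) w
    unfold GenLoop.transAt GenLoop.symmAt
    simp only [GenLoop.coe_copy]
    rw [hK]
    split_ifs with h1
    · rfl
    · change p (Q _) = p (Q _)
      congr 2
  -- `HomotopyGroup.mul_spec` reverses the order of concatenation, so the class of `p.comp K` is
  -- (p_*Q)⁻¹ · P, and p_*Q = P.
  have hnull : (p.comp K).HomotopicRel (ContinuousMap.const _ b₀)
      (Cube.boundary (Fin (n + 2))) := by
    have h1 := HomotopyGroup.mul_spec (i := (0 : Fin (n + 2)))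
      (p := GenLoop.symmAt 0 (genLoopMap p hp Q)) (q := P)
    have h2 := HomotopyGroup.inv_spec (i := (0 : Fin (n + 2))) (p := genLoopMap p hp Q)
    have h3 := (congrArg₂ (· * ·) (h2.symm.trans (congrArg (·⁻¹) hPQ)) rfl).symm.trans h1
    rw [hpK]
    exact Quotient.exact (h3.symm.trans (inv_mul_cancel (G := π_ (n + 2) B b₀) ⟦P⟧))
  obtain ⟨K', ⟨H'⟩, hK'⟩ := hfib.exists_lift_rel K hnull
  have hb : ∀ w ∈ Cube.boundary (Fin (n + 2)), K' w = K w := fun w hw =>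
    (H'.apply_one w).symm.trans (H'.eq_fst 1 hw)
  -- Coordinate 0 of `K'` becomes the time of a null-homotopy of `b` in the fibre; its boundary
  -- values are those of `K`.
  refine Quotient.sound ⟨⟨⟨⟨fun z => ⟨K' (Fin.cons z.1 z.2), ContinuousMap.congr_fun hK' _⟩, ?_⟩,
    ?_, ?_⟩, ?_⟩⟩
  · exact Continuous.subtype_mk (K'.continuous.comp (by fun_prop)) _
  · intro y
    refine Subtype.ext ?_
    change K' (Fin.cons 0 y) = (b y).1
    rw [hb _ ⟨0, by simp⟩, hK]
    simp [hH0]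
  · intro y
    refine Subtype.ext ?_
    change K' (Fin.cons 1 y) = e₀
    rw [hb _ ⟨0, by simp⟩, hK]
    have h1 : ¬ ((1 : ℝ) ≤ 1 / 2) := by norm_num
    have h2 : Set.projIcc (0 : ℝ) 1 zero_le_one (2 * 1 - 1) = 1 :=
      Set.projIcc_of_right_le _ (by norm_num)
    simp only [Fin.cons_zero, Set.Icc.coe_one, if_neg h1, h2, unitInterval.symm_one, Fin.tail_cons]
    exact Q.2 _ ⟨0, by simp⟩
  · intro t y hy
    refine Subtype.ext ?_
    change K' (Fin.cons t y) = (b y).1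
    rw [hb _ (cons_mem_boundary (Or.inr hy)), hK, ← hH0, hHb 0 y hy]
    split_ifs
    · simpa using hHb _ y hy
    · exact Q.2 _ (cons_mem_boundary (Or.inr (by simpa using hy)))

lemma IsSerreFibration.fibreIncl_injective (hfib : IsSerreFibration p) (hs : s b₀ = e₀)
    (hsec : (p.comp s).HomotopicRel (ContinuousMap.id B) {b₀}) :
    Function.Injective (inducedMap (x := (⟨e₀, hp⟩ : Fibre p b₀)) (y := e₀) (fibreIncl p b₀)
      (fibreIncl_base hp) (n + 1)) := by
  let φ : π_ (n + 1) (Fibre p b₀) ⟨e₀, hp⟩ →* π_ (n + 1) E e₀ :=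
    MonoidHom.mk' (inducedMap (y := e₀) (fibreIncl p b₀) (fibreIncl_base hp) (n + 1))
      (inducedMap_mul _ _)
  exact (injective_iff_map_eq_one φ).2 fun c hc => hfib.eq_one_of_eq_one hp s hs hsec c hc

end Exactness

/-! ### Generalized loops in products -/

section Products

variable {X Y : Type*} [TopologicalSpace X] [TopologicalSpace Y] {x : X} {y : Y} {k l n : ℕ}

/-- The first component of a generalized loop in a product. -/
def genLoopFst (f : GenLoop (Fin n) (X × Y) (x, y)) : GenLoop (Fin n) X x :=
  genLoopMap ContinuousMap.fst rfl f

/-- The second component of a generalized loop in a product. -/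
def genLoopSnd (f : GenLoop (Fin n) (X × Y) (x, y)) : GenLoop (Fin n) Y y :=
  genLoopMap ContinuousMap.snd rfl f

/-- The generalized loop in a product with given components. -/
def genLoopPair (f : GenLoop (Fin n) X x) (g : GenLoop (Fin n) Y y) :
    GenLoop (Fin n) (X × Y) (x, y) :=
  ⟨f.1.prodMk g.1, fun w hw => Prod.ext (f.2 w hw) (g.2 w hw)⟩

lemma homotopic_of_components {f g : GenLoop (Fin n) (X × Y) (x, y)}
    (h1 : GenLoop.Homotopic (genLoopFst f) (genLoopFst g))
    (h2 : GenLoop.Homotopic (genLoopSnd f) (genLoopSnd g)) : GenLoop.Homotopic f g := by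
  obtain ⟨H1⟩ := h1
  obtain ⟨H2⟩ := h2
  exact ⟨⟨⟨H1.toContinuousMap.prodMk H2.toContinuousMap,
    fun w => Prod.ext (H1.apply_zero w) (H2.apply_zero w),
    fun w => Prod.ext (H1.apply_one w) (H2.apply_one w)⟩,
    fun t w hw => Prod.ext (H1.eq_fst t hw) (H2.eq_fst t hw)⟩⟩

lemma genLoopFst_samelsonLoop [CommutatorHSpace X] [CommutatorHSpace Y]
    (f : GenLoop (Fin k) (X × Y) HSpace.e) (g : GenLoop (Fin l) (X × Y) HSpace.e) :
    genLoopFst (x := HSpace.e) (y := HSpace.e) (samelsonLoop f g) =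
      samelsonLoop (genLoopFst (x := HSpace.e) (y := HSpace.e) f)
        (genLoopFst (x := HSpace.e) (y := HSpace.e) g) := by
  refine GenLoop.ext _ _ fun w => ?_
  change (samelsonMap f g w).1 = samelsonMap _ _ w
  unfold samelsonMap
  split_ifs <;> rfl

lemma genLoopSnd_samelsonLoop [CommutatorHSpace X] [CommutatorHSpace Y]
    (f : GenLoop (Fin k) (X × Y) HSpace.e) (g : GenLoop (Fin l) (X × Y) HSpace.e) :
    genLoopSnd (x := HSpace.e) (y := HSpace.e) (samelsonLoop f g) =
      samelsonLoop (genLoopSnd (x := HSpace.e) (y := HSpace.e) f)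
        (genLoopSnd (x := HSpace.e) (y := HSpace.e) g) := by
  refine GenLoop.ext _ _ fun w => ?_
  change (samelsonMap f g w).2 = samelsonMap _ _ w
  unfold samelsonMap
  split_ifs <;> rfl

end Products

/-! ### The fibration in terms of fundamental groups of mapping spaces -/

section Transfer

variable {X Y : Type*} [TopologicalSpace X] [TopologicalSpace Y] {x : X} {y : Y} {k l n : ℕ}

/-- The bijection of `π_(n+1)(X)` with the fundamental group of `Ω^n X`. -/
def adjointClass (n : ℕ) (x : X) (a : π_ (n + 1) X x) :
    MapGroup (sphereRel n) (Cube.boundary (Fin n)) x :=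
  piClass n x (curryPi n x a)

/-- Bijectivity, the unit and naturality suffice to transfer the facts about p_*, s_* and i_*, so
the two group structures are never compared. -/
lemma adjointClass_bijective : Function.Bijective (adjointClass n x) :=
  ⟨piClass_injective.comp curryPi_injective, piClass_surjective.comp curryPi_surjective⟩

lemma adjointClass_one : adjointClass n x 1 = 1 := rfl

lemma adjointClass_inducedMap (f : C(X, Y)) (hf : f x = y) (a : π_ (n + 1) X x) :
    adjointClass n y (inducedMap f hf (n + 1) a) = mapGroupPush f hf (adjointClass n x a) := by
  unfold adjointClass
  rw [curryPi_inducedMap, piClass_inducedMap]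

variable {E B : Type*} [TopologicalSpace E] [TopologicalSpace B] {p : C(E, B)} {e₀ : E} {b₀ : B}
  (hp : p e₀ = b₀) (s : C(B, E)) (hs : s b₀ = e₀)

lemma inducedMap_fibreIncl (c : π_ (n + 1) (Fibre p b₀) ⟨e₀, hp⟩) :
    inducedMap p hp (n + 1)
      (inducedMap (y := e₀) (fibreIncl p b₀) (fibreIncl_base hp) (n + 1) c) = 1 := by
  induction c using Quotient.inductionOn with | _ c => ?_
  exact congrArg (Quotient.mk _) (GenLoop.ext _ _ fun w => (c w).2)

lemma push_section (hsec : (p.comp s).HomotopicRel (ContinuousMap.id B) {b₀})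
    (a : MapGroup (sphereRel n) (Cube.boundary (Fin n)) b₀) :
    mapGroupPush p hp (mapGroupPush s hs a) = a := by
  obtain ⟨a, rfl⟩ := adjointClass_bijective.2 a
  rw [← adjointClass_inducedMap, ← adjointClass_inducedMap, inducedMap_section hp s hs hsec]

lemma push_fibreIncl
    (c : MapGroup (sphereRel n) (Cube.boundary (Fin n)) (⟨e₀, hp⟩ : Fibre p b₀)) :
    mapGroupPush p hp (mapGroupPush (y := e₀) (fibreIncl p b₀) (fibreIncl_base hp) c) = 1 := by
  obtain ⟨c, rfl⟩ := adjointClass_bijective.2 c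
  rw [← adjointClass_inducedMap, ← adjointClass_inducedMap, inducedMap_fibreIncl,
    adjointClass_one]

lemma push_fibreIncl_injective (hfib : IsSerreFibration p) (hs : s b₀ = e₀)
    (hsec : (p.comp s).HomotopicRel (ContinuousMap.id B) {b₀}) :
    Function.Injective (mapGroupPush (R := sphereRel n) (A := Cube.boundary (Fin n))
      (x := (⟨e₀, hp⟩ : Fibre p b₀)) (y := e₀) (fibreIncl p b₀) (fibreIncl_base hp)) := by
  intro c d h
  obtain ⟨c, rfl⟩ := adjointClass_bijective.2 c
  obtain ⟨d, rfl⟩ := adjointClass_bijective.2 d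
  rw [← adjointClass_inducedMap, ← adjointClass_inducedMap] at h
  rw [hfib.fibreIncl_injective hp s hs hsec (adjointClass_bijective.1 h)]

lemma mem_range_push_fibreIncl (hfib : IsSerreFibration p)
    (a : MapGroup (sphereRel n) (Cube.boundary (Fin n)) e₀) (ha : mapGroupPush p hp a = 1) :
    ∃ c, mapGroupPush (x := (⟨e₀, hp⟩ : Fibre p b₀)) (y := e₀) (fibreIncl p b₀)
      (fibreIncl_base hp) c = a := by
  obtain ⟨a, rfl⟩ := adjointClass_bijective.2 a
  rw [← adjointClass_inducedMap, ← adjointClass_one] at ha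
  obtain ⟨c, rfl⟩ := hfib.mem_range_of_eq_one hp a (adjointClass_bijective.1 ha)
  exact ⟨adjointClass n _ c, (adjointClass_inducedMap _ _ _).symm⟩

/-- The map `Ωs` on generalized loops. -/
def sectionLoop (f : GenLoop (Fin n) (Path b₀ b₀) (Path.refl b₀)) :
    GenLoop (Fin n) (Path e₀ e₀) (Path.refl e₀) :=
  genLoopMap (loopMap s hs) (loopMap_refl s hs) f

/-- The map `Ωi` on generalized loops. -/
def inclLoop (f : GenLoop (Fin n) (Path (⟨e₀, hp⟩ : Fibre p b₀) ⟨e₀, hp⟩) (Path.refl _)) :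
    GenLoop (Fin n) (Path e₀ e₀) (Path.refl e₀) :=
  genLoopMap (loopMap (y := e₀) (fibreIncl p b₀) (fibreIncl_base hp))
    (loopMap_refl (y := e₀) (fibreIncl p b₀) (fibreIncl_base hp)) f

lemma sphereClass_sectionLoop (f : GenLoop (Fin n) (Path b₀ b₀) (Path.refl b₀)) :
    sphereClass (sectionLoop s hs f) = mapGroupPush s hs (sphereClass f) :=
  (mapGroupPush_mapClass s hs (sphereMapSet f)).symm

lemma sphereClass_inclLoop
    (f : GenLoop (Fin n) (Path (⟨e₀, hp⟩ : Fibre p b₀) ⟨e₀, hp⟩) (Path.refl _)) :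
    sphereClass (inclLoop hp f) =
      mapGroupPush (y := e₀) (fibreIncl p b₀) (fibreIncl_base hp) (sphereClass f) :=
  (mapGroupPush_mapClass (y := e₀) (fibreIncl p b₀) (fibreIncl_base hp) (sphereMapSet f)).symm

lemma genLoopMap_splittingMap
    (f : GenLoop (Fin n) (Path b₀ b₀ × Path (⟨e₀, hp⟩ : Fibre p b₀) ⟨e₀, hp⟩) HSpace.e) :
    genLoopMap (splittingMap p hp s hs) (splittingMap_base p hp s hs) f =
      loopTrans (sectionLoop s hs (genLoopFst (x := Path.refl b₀) (y := Path.refl _) f))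
        (inclLoop hp (genLoopSnd (x := Path.refl b₀) (y := Path.refl _) f)) :=
  rfl

/-- In the mapping group the class of φ_s(f) is i_*(f₂) · s_*(f₁). Here p_* is a retraction for s_*
whose kernel is the image of the injective map i_*, so each element factors uniquely in this way. -/
lemma inducedMap_splittingMap_bijective (hfib : IsSerreFibration p)
    (hsec : (p.comp s).HomotopicRel (ContinuousMap.id B) {b₀}) (n : ℕ) :
    Function.Bijective
      (inducedMap (splittingMap p hp s hs) (splittingMap_base p hp s hs) n) := by
  constructor
  · intro a b h
    induction a using Quotient.inductionOn with | _ f => ?_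
    induction b using Quotient.inductionOn with | _ g => ?_
    have h1 : sphereClass (loopTrans
        (sectionLoop s hs (genLoopFst (x := Path.refl b₀) (y := Path.refl _) f))
        (inclLoop hp (genLoopSnd (x := Path.refl b₀) (y := Path.refl _) f))) =
        sphereClass (loopTrans
          (sectionLoop s hs (genLoopFst (x := Path.refl b₀) (y := Path.refl _) g))
          (inclLoop hp (genLoopSnd (x := Path.refl b₀) (y := Path.refl _) g))) :=
      sphereClass_eq_iff.2 h
    rw [sphereClass_loopTrans, sphereClass_loopTrans, sphereClass_sectionLoop,
      sphereClass_sectionLoop, sphereClass_inclLoop, sphereClass_inclLoop] at h1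
    -- Applying p_* kills the fibre factors and isolates the base components.
    have h2 := congrArg (mapGroupPush p hp) h1
    rw [map_mul, map_mul, push_fibreIncl, push_fibreIncl, one_mul, one_mul,
      push_section hp s hs hsec, push_section hp s hs hsec] at h2
    rw [h2] at h1
    have h3 := push_fibreIncl_injective hp s hfib hs hsec (mul_right_cancel h1)
    exact Quotient.sound (homotopic_of_components (Quotient.exact (sphereClass_eq_iff.1 h2))
      (Quotient.exact (sphereClass_eq_iff.1 h3)))
  · intro a
    induction a using Quotient.inductionOn with | _ g => ?_
    obtain ⟨f1, hf1⟩ := sphereClass_surjective (mapGroupPush p hp (sphereClass g))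
    -- Dividing by s_*p_* of the class leaves an element of the kernel of p_*, the fibre component.
    obtain ⟨c, hc⟩ := mem_range_push_fibreIncl hp hfib
      (sphereClass g * (mapGroupPush s hs (sphereClass f1))⁻¹) (by
        rw [map_mul, map_inv, push_section hp s hs hsec, hf1, mul_inv_cancel])
    obtain ⟨f2, rfl⟩ := sphereClass_surjective c
    refine ⟨⟦genLoopPair f1 f2⟧, ?_⟩
    refine (sphereClass_eq_iff (f := loopTrans (sectionLoop s hs f1) (inclLoop hp f2))).1 ?_
    rw [sphereClass_loopTrans, sphereClass_sectionLoop, sphereClass_inclLoop, hc,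
      inv_mul_cancel_right]

/-! ### The brace product -/

lemma existsUnique_brace (hfib : IsSerreFibration p)
    (hsec : (p.comp s).HomotopicRel (ContinuousMap.id B) {b₀}) (α : π_ (k + 1) B b₀)
    (β : π_ (l + 1) (Fibre p b₀) ⟨e₀, hp⟩) :
    ∃! γ : π_ (k + l + 1) (Fibre p b₀) ⟨e₀, hp⟩,
      inducedMap (y := e₀) (fibreIncl p b₀) (fibreIncl_base hp) (k + l + 1) γ =
        whitehead (inducedMap s hs (k + 1) α)
          (inducedMap (fibreIncl p b₀) (fibreIncl_base hp) (l + 1) β) := by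
  refine existsUnique_of_exists_of_unique (hfib.mem_range_of_eq_one hp _ ?_)
    fun γ γ' h h' => hfib.fibreIncl_injective hp s hs hsec (h.trans h'.symm)
  rw [inducedMap_whitehead, inducedMap_fibreIncl, whitehead_one]

lemma brace_eq_one_iff (hfib : IsSerreFibration p)
    (hsec : (p.comp s).HomotopicRel (ContinuousMap.id B) {b₀}) (α : π_ (k + 1) B b₀)
    (β : π_ (l + 1) (Fibre p b₀) ⟨e₀, hp⟩) :
    brace p hp s hs α β = 1 ↔
      whitehead (inducedMap s hs (k + 1) α)
        (inducedMap (y := e₀) (fibreIncl p b₀) (fibreIncl_base hp) (l + 1) β) = 1 := by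
  have hb : inducedMap (y := e₀) (fibreIncl p b₀) (fibreIncl_base hp) (k + l + 1)
      (brace p hp s hs α β) =
      whitehead (inducedMap s hs (k + 1) α)
        (inducedMap (y := e₀) (fibreIncl p b₀) (fibreIncl_base hp) (l + 1) β) :=
    Function.invFun_eq (existsUnique_brace hp s hs hfib hsec α β).exists
  rw [← hb]
  constructor
  · intro h
    rw [h, inducedMap_one]
  · intro h
    exact hfib.fibreIncl_injective hp s hs hsec (h.trans (inducedMap_one _ _).symm)

lemma sphereClass_samelsonLoop_eq_adjointClass {α : π_ (k + 1) B b₀}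
    {β : π_ (l + 1) (Fibre p b₀) ⟨e₀, hp⟩} {f : GenLoop (Fin k) (Path b₀ b₀) (Path.refl b₀)}
    {g : GenLoop (Fin l) (Path (⟨e₀, hp⟩ : Fibre p b₀) ⟨e₀, hp⟩) (Path.refl _)}
    (hα : curryPi k b₀ α = ⟦f⟧) (hβ : curryPi l _ β = ⟦g⟧) :
    sphereClass (samelsonLoop (sectionLoop s hs f) (inclLoop hp g)) =
      adjointClass (k + l) e₀ (whitehead (inducedMap s hs (k + 1) α)
        (inducedMap (y := e₀) (fibreIncl p b₀) (fibreIncl_base hp) (l + 1) β)) := by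
  unfold adjointClass
  rw [curryPi_whitehead, curryPi_inducedMap, curryPi_inducedMap, hα, hβ]
  rfl

/-- Currying is surjective, so the adjoints of all α and β exhaust the classes of `ΩB` and `ΩF`,
degree 0 included. -/
lemma brace_vanishes_iff (hfib : IsSerreFibration p)
    (hsec : (p.comp s).HomotopicRel (ContinuousMap.id B) {b₀}) :
    (∀ (k l : ℕ) (α : π_ (k + 1) B b₀) (β : π_ (l + 1) (Fibre p b₀) ⟨e₀, hp⟩),
        brace p hp s hs α β = 1) ↔
      ∀ (k l : ℕ) (f : GenLoop (Fin k) (Path b₀ b₀) (Path.refl b₀))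
        (g : GenLoop (Fin l) (Path (⟨e₀, hp⟩ : Fibre p b₀) ⟨e₀, hp⟩) (Path.refl _)),
        sphereClass (samelsonLoop (sectionLoop s hs f) (inclLoop hp g)) = 1 := by
  constructor
  · intro h k l f g
    obtain ⟨α, hα⟩ := curryPi_surjective (⟦f⟧ : π_ k (Path b₀ b₀) (Path.refl b₀))
    obtain ⟨β, hβ⟩ := curryPi_surjective
      (⟦g⟧ : π_ l (Path (⟨e₀, hp⟩ : Fibre p b₀) ⟨e₀, hp⟩) (Path.refl _))
    rw [sphereClass_samelsonLoop_eq_adjointClass hp s hs hα hβ,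
      (brace_eq_one_iff hp s hs hfib hsec _ _).1 (h k l _ _), adjointClass_one]
  · intro h k l α β
    obtain ⟨f, hf⟩ := Quotient.exists_rep (curryPi k b₀ α)
    obtain ⟨g, hg⟩ := Quotient.exists_rep (curryPi l _ β)
    rw [brace_eq_one_iff hp s hs hfib hsec]
    refine adjointClass_bijective.1 ?_
    rw [← sphereClass_samelsonLoop_eq_adjointClass hp s hs hf.symm hg.symm, h, adjointClass_one]

/-! ### Samelson products under the splitting map -/

lemma genLoopMap_splittingMap_samelsonLoop
    (f : GenLoop (Fin k) (Path b₀ b₀ × Path (⟨e₀, hp⟩ : Fibre p b₀) ⟨e₀, hp⟩) HSpace.e)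
    (g : GenLoop (Fin l) (Path b₀ b₀ × Path (⟨e₀, hp⟩ : Fibre p b₀) ⟨e₀, hp⟩) HSpace.e) :
    genLoopMap (splittingMap p hp s hs) (splittingMap_base p hp s hs) (samelsonLoop f g) =
      loopTrans
        (samelsonLoop (sectionLoop s hs (genLoopFst (x := Path.refl b₀) (y := Path.refl _) f))
          (sectionLoop s hs (genLoopFst (x := Path.refl b₀) (y := Path.refl _) g)))
        (samelsonLoop (inclLoop hp (genLoopSnd (x := Path.refl b₀) (y := Path.refl _) f))
          (inclLoop hp (genLoopSnd (x := Path.refl b₀) (y := Path.refl _) g))) := by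
  rw [genLoopMap_splittingMap]
  have h1 := genLoopFst_samelsonLoop f g
  have h2 := genLoopSnd_samelsonLoop f g
  refine (congrArg₂ (fun a b => loopTrans (sectionLoop s hs a) (inclLoop hp b)) h1 h2).trans ?_
  exact congrArg₂ loopTrans (genLoopMap_samelsonLoop s hs _ _)
    (genLoopMap_samelsonLoop (y := e₀) (fibreIncl p b₀) (fibreIncl_base hp) _ _)

/-- Bijectivity and multiplicativity in positive degrees hold regardless of `h`, which is used only
for the product on π_0 and for Samelson products. -/
lemma isSamelsonAlgebraIso_of_samelson (hfib : IsSerreFibration p)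
    (hsec : (p.comp s).HomotopicRel (ContinuousMap.id B) {b₀})
    (h : ∀ (k l : ℕ) (f : GenLoop (Fin k) (Path b₀ b₀) (Path.refl b₀))
      (g : GenLoop (Fin l) (Path (⟨e₀, hp⟩ : Fibre p b₀) ⟨e₀, hp⟩) (Path.refl _)),
      sphereClass (samelsonLoop (sectionLoop s hs f) (inclLoop hp g)) = 1) :
    IsSamelsonAlgebraIso (splittingMap p hp s hs) (splittingMap_base p hp s hs) where
  bijective := inducedMap_splittingMap_bijective hp s hs hfib hsec
  map_mul n a b := inducedMap_mul _ _ a b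
  map_zerothMul a b := by
    induction a using Quotient.inductionOn with | _ f => ?_
    induction b using Quotient.inductionOn with | _ g => ?_
    let f1 := genLoopFst (x := Path.refl b₀) (y := Path.refl _) f
    let f2 := genLoopSnd (x := Path.refl b₀) (y := Path.refl _) f
    let g1 := genLoopFst (x := Path.refl b₀) (y := Path.refl _) g
    let g2 := genLoopSnd (x := Path.refl b₀) (y := Path.refl _) g
    refine (sphereClass_eq_iff
      (f := loopTrans (sectionLoop s hs (loopTrans f1 g1)) (inclLoop hp (loopTrans f2 g2)))
      (g := loopTrans (loopTrans (sectionLoop s hs f1) (inclLoop hp f2))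
        (loopTrans (sectionLoop s hs g1) (inclLoop hp g2)))).1 ?_
    simp only [sphereClass_loopTrans, sphereClass_sectionLoop, sphereClass_inclLoop, map_mul]
    -- The two words differ only by the order of the inner factors i_*(f₂) and s_*(g₁), whose
    -- bracket in bidegree (0, 0) vanishes.
    have hc := commute_of_samelson_diag (h 0 0 g1 f2)
    rw [sphereClass_sectionLoop, sphereClass_inclLoop] at hc
    rw [mul_assoc, ← mul_assoc _ _ (mapGroupPush s hs (sphereClass f1)), ← hc.eq]
    simp only [mul_assoc]
  map_samelson k l a b := by
    induction a using Quotient.inductionOn with | _ f => ?_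
    induction b using Quotient.inductionOn with | _ g => ?_
    refine (congrArg (Quotient.mk _) (genLoopMap_splittingMap_samelsonLoop hp s hs f g)).trans ?_
    exact (sphereClass_eq_iff.1 (sphereClass_samelsonLoop_loopTrans (h _ _ _ _) (h _ _ _ _)
      (h _ _ _ _) (h _ _ _ _))).symm

lemma samelson_of_isSamelsonAlgebraIso
    (h : IsSamelsonAlgebraIso (splittingMap p hp s hs) (splittingMap_base p hp s hs))
    (f : GenLoop (Fin k) (Path b₀ b₀) (Path.refl b₀))
    (g : GenLoop (Fin l) (Path (⟨e₀, hp⟩ : Fibre p b₀) ⟨e₀, hp⟩) (Path.refl _)) :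
    sphereClass (samelsonLoop (sectionLoop s hs f) (inclLoop hp g)) = 1 := by
  -- The pairs (f, 1) and (1, g) have trivial Samelson product in ΩB × ΩF, while φ_s sends them to
  -- s_*f and i_*g.
  have h1 := h.map_samelson k l ⟦genLoopPair f GenLoop.const⟧ ⟦genLoopPair GenLoop.const g⟧
  have e1 : inducedMap (splittingMap p hp s hs) (splittingMap_base p hp s hs) k
      ⟦genLoopPair f GenLoop.const⟧ = ⟦sectionLoop s hs f⟧ := by
    refine (sphereClass_eq_iff
      (f := loopTrans (sectionLoop s hs f) (inclLoop hp GenLoop.const))).1 ?_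
    rw [sphereClass_loopTrans, sphereClass_inclLoop, sphereClass_const, map_one, one_mul]
  have e2 : inducedMap (splittingMap p hp s hs) (splittingMap_base p hp s hs) l
      ⟦genLoopPair GenLoop.const g⟧ = ⟦inclLoop hp g⟧ := by
    refine (sphereClass_eq_iff
      (f := loopTrans (sectionLoop s hs GenLoop.const) (inclLoop hp g))).1 ?_
    rw [sphereClass_loopTrans, sphereClass_sectionLoop, sphereClass_const, map_one, mul_one]
  rw [e1, e2] at h1
  have h2 := (congrArg (Quotient.mk _) (genLoopMap_splittingMap_samelsonLoop hp s hs
    (genLoopPair f GenLoop.const) (genLoopPair GenLoop.const g))).symm.trans h1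
  refine (sphereClass_eq_iff.2 h2).symm.trans ?_
  -- In each component of the product one of the two arguments is constant, so both brackets vanish.
  rw [sphereClass_loopTrans, samelson_of_commute, samelson_of_commute, one_mul]
  · refine (?_ : pullSnd k l e₀ (sphereClass (sectionLoop s hs GenLoop.const)) = 1) ▸
      Commute.one_right _
    rw [sphereClass_sectionLoop, sphereClass_const, map_one, map_one]
  · refine (?_ : pullFst k l e₀ (sphereClass (inclLoop hp GenLoop.const)) = 1) ▸
      Commute.one_left _
    rw [sphereClass_inclLoop, sphereClass_const, map_one, map_one]

end Transfer

end BraceProduct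

end

open BraceProduct in
theorem mainTheorem2 {E B : Type*} [TopologicalSpace E] [TopologicalSpace B]
    (p : C(E, B)) (hfib : IsSerreFibration p) (e₀ : E) (b₀ : B) (hp : p e₀ = b₀)
    (s : C(B, E)) (hs : s b₀ = e₀)
    (hsec : (p.comp s).HomotopicRel (ContinuousMap.id B) {b₀}) :
    (∀ (k l : ℕ) (α : π_ (k + 1) B b₀) (β : π_ (l + 1) (Fibre p b₀) ⟨e₀, hp⟩),
      ∃! γ : π_ (k + l + 1) (Fibre p b₀) ⟨e₀, hp⟩,
        inducedMap (y := e₀) (fibreIncl p b₀) rfl (k + l + 1) γ =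
          whitehead (inducedMap s hs (k + 1) α)
            (inducedMap (fibreIncl p b₀) rfl (l + 1) β)) ∧
    ((∀ (k l : ℕ) (α : π_ (k + 1) B b₀) (β : π_ (l + 1) (Fibre p b₀) ⟨e₀, hp⟩),
        brace p hp s hs α β = 1) ↔
      IsSamelsonAlgebraIso (splittingMap p hp s hs) (splittingMap_base p hp s hs)) := by
  refine ⟨fun k l α β => existsUnique_brace hp s hs hfib hsec α β, ?_⟩
  rw [brace_vanishes_iff hp s hs hfib hsec]
  exact ⟨isSamelsonAlgebraIso_of_samelson hp s hs hfib hsec,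
    fun h _ _ => samelson_of_isSamelsonAlgebraIso hp s hs h⟩
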